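/- Let $N\ge 1$ and $k\ge 2$ be integers, let $\chi$ be a Dirichlet character modulo $N$, and write $\Gamma=\mathrm{SL}_2(\mathbb Z)$ and $\mathbb H=\{\tau=x+iy : y>0\}$. Let $f$ and $g$ be two cusp forms in $S_k(\Gamma_0(N),\chi)$, and let $$\Gamma=\bigsqcup_{j=1}^r\Gamma_0(N)\gamma_j$$ be a right coset decomposition. Put $f_j=f|_k\gamma_j$ and $g_j=g|_k\gamma_j$, where $(f|_k\gamma)(\tau)=(c\tau+d)^{-k}f\bigl(\frac{a\tau+b}{c\tau+d}\bigr)$ for $\gamma=\begin{pmatrix}a&b\\c&d\end{pmatrix}\in\Gamma$. For a function $h$ on $\mathbb H$ and points $a,b$ of the completed upper half-plane set $$I_n(a,b,h)=\int_a^b\tau^n h(\tau)\,d\tau,$$ the integral being taken along the geodesic arc from $a$ to $b$. Let $$\langle f,g\rangle_{\Gamma_0(N)}=\frac1{[\Gamma:\Gamma_0(N)]}\int_{\Gamma_0(N)\backslash\mathbb H}f(\tau)\,\overline{g(\tau)}\,y^k\,\frac{dx\,dy}{y^2}$$ be the normalized Petersson scalar product, where the integral is computed on a fundamental domain for the action of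 $\Gamma_0(N)$ on $\mathbb H$. Then such a fundamental domain exists; for every choice of it the integral defining $\langle f,g\rangle_{\Gamma_0(N)}$ converges absolutely; for all $1\le j\le r$ and $0\le n\le k-2$ the integrals $I_n(0,i\infty,f_j)$ and $I_n(-1,1,g_j)$ converge absolutely; and $$6r(2i)^{k-1}\langle f,g\rangle_{\Gamma_0(N)}=\sum_{j=1}^r\sum_{n=0}^{k-2}(-1)^n\binom{k-2}{n}\,I_{k-2-n}(0,i\infty,f_j)\,\overline{I_n(-1,1,g_j)}.$$ -/

import Mathlib

open UpperHalfPlane CongruenceSubgroup MeasureTheory Set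
open scoped MatrixGroups ModularForm ComplexConjugate OnePoint

noncomputable section

namespace HaberlandPetersson

/-- The space `S_k(Γ₀(N), χ)`: the cusp forms `f` of weight `k` on `Γ₁(N)` such that
`(f ∣[k] γ) = χ(d) f` for every `γ = (a b; c d) ∈ Γ₀(N)`. -/
def cuspFormsWithCharacter (N : ℕ) (k : ℤ) (χ : DirichletCharacter ℂ N) :
    Submodule ℂ (CuspForm ((Gamma1 N).map (Matrix.SpecialLinearGroup.mapGL ℝ)) k) where
  carrier := {f | ∀ γ ∈ Gamma0 N, (f : ℍ → ℂ) ∣[k] γ = χ ((γ 1 1 : ℤ) : ZMod N) • (f : ℍ → ℂ)}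
  zero_mem' := fun γ _ => by simp
  add_mem' := fun {f g} hf hg γ hγ => by
    rw [FunLike.coe_add, SlashAction.add_slash, hf γ hγ, hg γ hγ, smul_add]
  smul_mem' := fun c f hf γ hγ => by
    rw [FunLike.coe_smul, ModularForm.SL_smul_slash, hf γ hγ, smul_comm]

/-- `γ_1, …, γ_r` are representatives of the right cosets of `Γ₀(N)` in `SL₂(ℤ)`:
`SL₂(ℤ)` is the disjoint union of the cosets `Γ₀(N) γ_j`. -/
def IsRightCosetDecomposition (N : ℕ) {r : ℕ} (γ : Fin r → SL(2, ℤ)) : Prop :=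
  (⋃ j, {δ : SL(2, ℤ) | ∃ α ∈ Gamma0 N, δ = α * γ j}) = univ ∧
    Pairwise fun i j => Disjoint {δ : SL(2, ℤ) | ∃ α ∈ Gamma0 N, δ = α * γ i}
      {δ : SL(2, ℤ) | ∃ α ∈ Gamma0 N, δ = α * γ j}

/-- `Γ₀(N)` as a group of transformations of the upper half-plane, that is, modulo its subgroup
`{±1}`, which acts trivially. -/
abbrev gamma0Transformations (N : ℕ) : Subgroup (Equiv.Perm ℍ) :=
  (Gamma0 N).map (MulAction.toPermHom SL(2, ℤ) ℍ)

/-- `D` is a fundamental domain for `Γ₀(N)` acting on the upper half-plane, with respect to the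
invariant measure `dx dy / y²`. -/
def IsGamma0FundamentalDomain (N : ℕ) (D : Set ℍ) : Prop :=
  IsFundamentalDomain (gamma0Transformations N) D (volume : Measure ℍ)

/-- The normalized Petersson scalar product
`⟨f, g⟩ = [SL₂(ℤ) : Γ₀(N)]⁻¹ ∫ f(τ) conj(g(τ)) y^k dx dy / y²`, the integral over
`Γ₀(N)\ℍ` being computed on the fundamental domain `D`. -/
def peterssonProduct (N : ℕ) (k : ℤ) (D : Set ℍ) (f g : ℍ → ℂ) : ℂ :=
  ((Gamma0 N).index : ℂ)⁻¹ * ∫ τ in D, f τ * conj (g τ) * ((τ.im ^ k : ℝ) : ℂ)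

/-- The integrand `τ ↦ τⁿ h(τ)`, for `τ` a complex number in the upper half-plane. -/
def periodIntegrand (n : ℕ) (h : ℍ → ℂ) (τ : ℂ) : ℂ := τ ^ n * h (ofComplex τ)

/-- The center of the semicircle through `a` and `b` orthogonal to the real axis, `Re a ≠ Re b`. -/
def arcCenter (a b : ℂ) : ℝ :=
  (Complex.normSq a - Complex.normSq b) / (2 * (a.re - b.re))

/-- The radius of the semicircle through `a` and `b` orthogonal to the real axis. -/
def arcRadius (a b : ℂ) : ℝ := ‖a - arcCenter a b‖

/-- The pullback of the form `τⁿ h(τ) dτ` to the vertical line `y ↦ x + i y`. -/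
def lineIntegrand (n : ℕ) (h : ℍ → ℂ) (x y : ℝ) : ℂ :=
  periodIntegrand n h (x + y * Complex.I) * Complex.I

/-- The pullback of the form `τⁿ h(τ) dτ` to the circle `θ ↦ c + R e^{i θ}`. -/
def arcIntegrand (n : ℕ) (h : ℍ → ℂ) (c R θ : ℝ) : ℂ :=
  periodIntegrand n h (c + R * Complex.exp (θ * Complex.I)) *
    (R * Complex.I * Complex.exp (θ * Complex.I))

/-- `I_n(a, b, h) = ∫_a^b τⁿ h(τ) dτ`, the integral being taken along the geodesic from `a` to `b`,
where `a` and `b` are points of the upper half-plane, real numbers, or the point `i∞`. -/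
def periodIntegral (n : ℕ) : OnePoint ℂ → OnePoint ℂ → (ℍ → ℂ) → ℂ
  | OnePoint.infty, OnePoint.infty, _ => 0
  | OnePoint.some a, OnePoint.infty, h => ∫ y in Ioi a.im, lineIntegrand n h a.re y
  | OnePoint.infty, OnePoint.some b, h => -∫ y in Ioi b.im, lineIntegrand n h b.re y
  | OnePoint.some a, OnePoint.some b, h =>
    if a.re = b.re then ∫ y in a.im..b.im, lineIntegrand n h a.re y
    else ∫ θ in (Complex.arg (a - arcCenter a b))..(Complex.arg (b - arcCenter a b)),
      arcIntegrand n h (arcCenter a b) (arcRadius a b) θ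

/-- The integral defining `I_n(a, b, h)` converges absolutely. -/
def PeriodIntegrable (n : ℕ) : OnePoint ℂ → OnePoint ℂ → (ℍ → ℂ) → Prop
  | OnePoint.infty, OnePoint.infty, _ => True
  | OnePoint.some a, OnePoint.infty, h => IntegrableOn (lineIntegrand n h a.re) (Ioi a.im)
  | OnePoint.infty, OnePoint.some b, h => IntegrableOn (lineIntegrand n h b.re) (Ioi b.im)
  | OnePoint.some a, OnePoint.some b, h =>
    if a.re = b.re then IntervalIntegrable (lineIntegrand n h a.re) volume a.im b.im
    else IntervalIntegrable (arcIntegrand n h (arcCenter a b) (arcRadius a b)) volume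
      (Complex.arg (a - arcCenter a b)) (Complex.arg (b - arcCenter a b))

end HaberlandPetersson

end

namespace HaberlandPetersson

open Filter Topology Metric ModularGroup Modular
open scoped Pointwise Manifold

/-! Write `k = m + 2`. For a pair `u = f_j`, `v = g_j`, put `E(z, w) = ∫_{i∞}^z u(ζ) (ζ - w)^m dζ`
(`eichlerIntegral`) and consider the form `P(z) dz̄`, with `P(z) = conj (v z) * E(z, z̄)`
(`eichlerPairing`). Its exterior derivative is `conj (v z) u(z) (z - z̄)^m dz ∧ dz̄`, which is a
constant times the Petersson density, because `z - z̄ = 2iy`.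

Stokes' theorem is applied on the ideal triangle with vertices `-1`, `1`, `i∞`
(`eichlerPairing_stokes`). After summation over the cosets, two symmetries dispose of the boundary.
Right translation by an element of `SL₂(ℤ)` permutes the cosets, and the character values cancel in
sesquilinear expressions (`slashInvariantSum_of_character`). Hence `T²`, which carries the line `Re
= -1` to `Re = 1`, makes the vertical sides cancel. `S` maps the unit semicircle to itself with
reversed orientation. The arc integral `J` would therefore be its own negative, were it not for the
base point `i∞` of `E`, which `S` moves to `0`. The correction is the period polynomial `E(0, w)`
(`eichlerIntegral_slash_S`), so `2J = iK`, where `K` is the double sum of products of periods; this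
is `haberland_thetaDomain`.

The triangle consists, up to null sets, of three copies of the standard domain of `SL₂(ℤ)`
(`setIntegral_thetaDomain`), and the sum over cosets of integrals over the standard domain is the
integral over any fundamental domain of `Γ₀(N)` (`setIntegral_gamma0FundamentalDomain`). The factor
`3` and the `2` from `2J = iK` give the `6`.

All vertices of the triangle are cusps. The analysis rests on the fact that a cusp form is bounded
in a cone at each of the cusps `-1`, `0`, `1` (`bounded_cone`). This gives one exponential bound,
uniform on the whole triangle, which justifies every limit and every exchange of integrals. -/

/-! ### Primitives along vertical rays -/

/-- Holomorphic functions on the upper half-plane which, locally uniformly in the starting point,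
decay exponentially along upward vertical rays. -/
structure VerticallyDecaying (u : ℂ → ℂ) : Prop where
  differentiableOn : DifferentiableOn ℂ u upperHalfPlaneSet
  decay : ∀ z : ℂ, 0 < z.im → ∃ δ C c : ℝ, 0 < δ ∧ 0 < c ∧
    ∀ w ∈ ball z δ, ∀ t : ℝ, 0 ≤ t → ‖u (w + t * Complex.I)‖ ≤ C * Real.exp (-c * t)

/-- The integral of `u` along the vertical line from `i∞` to `z`. -/
noncomputable def verticalPrimitive (u : ℂ → ℂ) (z : ℂ) : ℂ :=
  -Complex.I * ∫ t in Ioi (0 : ℝ), u (z + t * Complex.I)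

lemma integrableOn_const_mul_exp (C : ℝ) {c : ℝ} (hc : 0 < c) :
    IntegrableOn (fun t : ℝ => C * Real.exp (-c * t)) (Ioi 0) :=
  (exp_neg_integrableOn_Ioi 0 hc).const_mul C

lemma integral_const_mul_exp (C : ℝ) {c : ℝ} (hc : 0 < c) :
    ∫ t in Ioi (0 : ℝ), C * Real.exp (-c * t) = C / c := by
  rw [integral_const_mul, integral_exp_mul_Ioi (neg_lt_zero.mpr hc)]
  simp [div_eq_mul_inv]

lemma im_add_mul_I (z : ℂ) (t : ℝ) : (z + t * Complex.I).im = z.im + t := by simp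

lemma add_mul_I_mem {z : ℂ} (hz : 0 < z.im) {t : ℝ} (ht : 0 ≤ t) :
    z + t * Complex.I ∈ upperHalfPlaneSet := by
  simp only [upperHalfPlaneSet, mem_ofPred_eq, im_add_mul_I]
  positivity

lemma im_pos_of_mem_ball {z w : ℂ} {δ : ℝ} (hδ : δ ≤ z.im) (hw : w ∈ ball z δ) : 0 < w.im := by
  have h1 : |(w - z).im| ≤ ‖w - z‖ := Complex.abs_im_le_norm _
  have h2 : ‖w - z‖ < δ := by simpa [dist_eq_norm] using hw
  have h3 := (abs_le.mp h1).1
  simp only [Complex.sub_im] at h3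
  linarith

lemma _root_.ContinuousOn.comp_vertical {u : ℂ → ℂ} (hu : ContinuousOn u upperHalfPlaneSet) {z : ℂ}
    (hz : 0 ≤ z.im) : ContinuousOn (fun t : ℝ => u (z + t * Complex.I)) (Ioi 0) := by
  refine hu.comp (by fun_prop) fun t ht => ?_
  simp only [upperHalfPlaneSet, mem_ofPred_eq, im_add_mul_I]
  exact add_pos_of_nonneg_of_pos hz ht

lemma _root_.ContinuousOn.aestronglyMeasurable_vertical {u : ℂ → ℂ}
    (hu : ContinuousOn u upperHalfPlaneSet) {z : ℂ} (hz : 0 ≤ z.im) :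
    AEStronglyMeasurable (fun t : ℝ => u (z + t * Complex.I)) (volume.restrict (Ioi 0)) :=
  (hu.comp_vertical hz).aestronglyMeasurable measurableSet_Ioi

lemma integrableOn_vertical_of_le {u : ℂ → ℂ} (hu : ContinuousOn u upperHalfPlaneSet) {z : ℂ}
    (hz : 0 ≤ z.im) {C c : ℝ} (hc : 0 < c)
    (h : ∀ t : ℝ, 0 < t → ‖u (z + t * Complex.I)‖ ≤ C * Real.exp (-c * t)) :
    IntegrableOn (fun t : ℝ => u (z + t * Complex.I)) (Ioi 0) := by
  refine (integrableOn_const_mul_exp C hc).mono' (hu.aestronglyMeasurable_vertical hz) ?_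
  filter_upwards [ae_restrict_mem measurableSet_Ioi] with t ht using h t ht

lemma norm_verticalPrimitive_le {u : ℂ → ℂ} {z : ℂ} {C c : ℝ} (hc : 0 < c)
    (h : ∀ t : ℝ, 0 < t → ‖u (z + t * Complex.I)‖ ≤ C * Real.exp (-c * t)) :
    ‖verticalPrimitive u z‖ ≤ C / c := by
  rw [verticalPrimitive, norm_mul, norm_neg, Complex.norm_I, one_mul, ← integral_const_mul_exp C hc]
  refine norm_integral_le_of_norm_le (integrableOn_const_mul_exp C hc) ?_
  filter_upwards [ae_restrict_mem measurableSet_Ioi] with t ht using h t ht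

namespace VerticallyDecaying

variable {u v : ℂ → ℂ}

lemma differentiableAt (hu : VerticallyDecaying u) {z : ℂ} (hz : 0 < z.im) :
    DifferentiableAt ℂ u z :=
  hu.differentiableOn.differentiableAt (isOpen_upperHalfPlaneSet.mem_nhds hz)

lemma integrableOn (hu : VerticallyDecaying u) {z : ℂ} (hz : 0 < z.im) :
    IntegrableOn (fun t : ℝ => u (z + t * Complex.I)) (Ioi 0) := by
  obtain ⟨δ, C, c, hδ, hc, h⟩ := hu.decay z hz
  exact integrableOn_vertical_of_le hu.differentiableOn.continuousOn hz.le hc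
    fun t ht => h z (mem_ball_self hδ) t ht.le

/-- Cauchy's estimate on discs of fixed radius transfers the decay, with the same exponent, from a
function to its derivative. -/
lemma deriv (hu : VerticallyDecaying u) : VerticallyDecaying (deriv u) := by
  refine ⟨hu.differentiableOn.deriv isOpen_upperHalfPlaneSet, fun z hz => ?_⟩
  obtain ⟨δ, C, c, hδ, hc, h⟩ := hu.decay z hz
  set ε := min δ z.im with hε
  have hε0 : 0 < ε := lt_min hδ hz
  refine ⟨ε / 2, C / (ε / 4), c, by positivity, hc, fun w hw t ht => ?_⟩
  have key : ∀ p : ℂ, dist p (w + t * Complex.I) ≤ ε / 4 → p - t * Complex.I ∈ ball z ε := by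
    intro p hp
    have hw' : dist w z < ε / 2 := hw
    have e : p - t * Complex.I - z = (p - (w + t * Complex.I)) + (w - z) := by ring
    rw [mem_ball, dist_eq_norm, e]
    rw [dist_eq_norm] at hp hw'
    exact (norm_add_le _ _).trans_lt (by linarith)
  have hpos : ∀ p : ℂ, dist p (w + t * Complex.I) ≤ ε / 4 → p ∈ upperHalfPlaneSet := by
    intro p hp
    have h1 := im_pos_of_mem_ball (min_le_right _ _) (key p hp)
    simp at h1
    show 0 < p.im
    linarith
  -- The centre moves by less than `ε / 2` and the radius is `ε / 4`, so after shifting back by `t`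
  -- the disc stays in the ball of radius `ε`, where both positivity of the height and the decay
  -- bound are available.
  refine (Complex.norm_deriv_le_of_forall_mem_sphere_norm_le (R := ε / 4)
    (C := C * Real.exp (-c * t)) (by positivity) ?_ ?_).trans_eq (by ring)
  · refine DifferentiableOn.diffContOnCl (hu.differentiableOn.mono fun p hp => hpos p ?_)
    exact mem_closedBall.mp (closure_ball_subset_closedBall hp)
  · intro p hp
    have h2 := h _ (ball_subset_ball (min_le_left _ _) (key p (mem_sphere.mp hp).le)) t ht
    simpa using h2

/-- The fundamental theorem of calculus for `verticalPrimitive`. -/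
lemma hasDerivAt_verticalPrimitive (hu : VerticallyDecaying u) {z : ℂ} (hz : 0 < z.im) :
    HasDerivAt (verticalPrimitive u) (u z) z := by
  obtain ⟨δ, C, c, hδ, hc, h⟩ := hu.deriv.decay z hz
  set ε := min δ z.im with hε
  have hε0 : 0 < ε := lt_min hδ hz
  have him : ∀ w ∈ ball z ε, 0 < w.im := fun w hw => im_pos_of_mem_ball (min_le_right _ _) hw
  have hd : ∀ w : ℂ, 0 < w.im → ∀ t : ℝ, 0 ≤ t →
      HasDerivAt u (_root_.deriv u (w + t * Complex.I)) (w + t * Complex.I) := fun w hw t ht =>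
    (hu.differentiableAt (add_mul_I_mem hw ht)).hasDerivAt
  have main := (hasDerivAt_integral_of_dominated_loc_of_deriv_le (μ := volume.restrict (Ioi 0))
    (F := fun w (t : ℝ) => u (w + t * Complex.I))
    (F' := fun w (t : ℝ) => _root_.deriv u (w + t * Complex.I))
    (bound := fun t => C * Real.exp (-c * t)) (ball_mem_nhds z hε0)
    (by
      filter_upwards [ball_mem_nhds z hε0] with w hw
      exact hu.differentiableOn.continuousOn.aestronglyMeasurable_vertical (him w hw).le)
    (hu.integrableOn hz)
    (hu.deriv.differentiableOn.continuousOn.aestronglyMeasurable_vertical hz.le)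
    (by
      filter_upwards [ae_restrict_mem measurableSet_Ioi] with t ht w hw
      exact h w (ball_subset_ball (min_le_left _ _) hw) t (le_of_lt ht))
    (integrableOn_const_mul_exp C hc)
    (by
      filter_upwards [ae_restrict_mem measurableSet_Ioi] with t ht w hw
      simpa using (hd w (him w hw) t (le_of_lt ht)).comp_add_const w (t * Complex.I))).2
  -- Differentiation under the integral sign produces the integral of `u'`. Since `i u'` is the
  -- derivative of `u` along the ray, that integral reduces to the boundary value `-u(z)`.
  have ftc : ∫ t in Ioi (0 : ℝ), Complex.I * _root_.deriv u (z + t * Complex.I) =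
      0 - u (z + (0 : ℝ) * Complex.I) := by
    refine integral_Ioi_of_hasDerivAt_of_tendsto'
      (f := fun t : ℝ => u (z + t * Complex.I)) (fun t ht => ?_)
      ((hu.deriv.integrableOn hz).const_mul _) ?_
    · have h1 : HasDerivAt (fun t : ℝ => z + t * Complex.I) Complex.I t := by
        simpa using ((Complex.ofRealCLM.hasDerivAt (x := t)).mul_const Complex.I).const_add z
      exact (hd z hz t ht).scomp t h1
    · obtain ⟨δ', C', c', hδ', hc', h'⟩ := hu.decay z hz
      refine squeeze_zero_norm' ?_ (a := fun t => C' * Real.exp (-c' * t)) ?_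
      · filter_upwards [eventually_ge_atTop 0] with t ht using h' z (mem_ball_self hδ') t ht
      · have : Tendsto (fun t : ℝ => -c' * t) atTop atBot :=
          tendsto_id.const_mul_atTop_of_neg (neg_lt_zero.mpr hc')
        simpa using (Real.tendsto_exp_atBot.comp this).const_mul C'
  have := main.const_mul (-Complex.I)
  convert! this using 1
  rw [integral_const_mul] at ftc
  rw [neg_mul, ftc]
  simp

/-- Integrating `C e^{-c(t+s)}` over `s` costs only a factor `1 / c`, so primitives stay in the
class. -/
lemma verticalPrimitive (hu : VerticallyDecaying u) :
    VerticallyDecaying (verticalPrimitive u) := by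
  refine ⟨fun z hz => (hu.hasDerivAt_verticalPrimitive hz).differentiableAt.differentiableWithinAt,
    fun z hz => ?_⟩
  obtain ⟨δ, C, c, hδ, hc, h⟩ := hu.decay z hz
  refine ⟨δ, C / c, c, hδ, hc, fun w hw t ht => ?_⟩
  refine (norm_verticalPrimitive_le (C := C * Real.exp (-c * t)) hc fun s hs => ?_).trans_eq
    (by ring)
  have := h w hw (t + s) (by positivity)
  rw [mul_add, Real.exp_add, ← mul_assoc] at this
  convert this using 3
  push_cast
  ring

end VerticallyDecaying

/-! ### Stokes' theorem on the ideal triangle, by differentiating ray integrals -/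

/-- Uniform exponential decay along the vertical rays which start on the upper unit semicircle. -/
def DecaysAboveCircle (u : ℂ → ℂ) : Prop :=
  ∃ C c : ℝ, 0 < c ∧ ∀ θ ∈ Icc (0 : ℝ) Real.pi, ∀ s : ℝ, 0 ≤ s → 0 < Real.sin θ + s →
    ‖u (Complex.exp (θ * Complex.I) + s * Complex.I)‖ ≤ C * Real.exp (-c * s)

lemma exp_mul_I_im (θ : ℝ) : (Complex.exp (θ * Complex.I)).im = Real.sin θ := by
  rw [Complex.exp_ofReal_mul_I_im]

lemma hasDerivAt_exp_mul_I (θ : ℝ) :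
    HasDerivAt (fun θ : ℝ => Complex.exp (θ * Complex.I))
      (Complex.I * Complex.exp (θ * Complex.I)) θ := by
  have h := ((Complex.ofRealCLM.hasDerivAt (x := θ)).mul_const Complex.I).cexp
  simpa [mul_comm] using h

lemma norm_I_mul_exp_mul_I (θ : ℝ) : ‖Complex.I * Complex.exp (θ * Complex.I)‖ = 1 := by
  rw [norm_mul, Complex.norm_I, Complex.norm_exp_ofReal_mul_I, one_mul]

/-- For the primitive the bound persists at the corners `±1` themselves (`s = 0`, `sin θ = 0`),
because the ray integral only sees points strictly above its origin. -/
lemma DecaysAboveCircle.norm_verticalPrimitive_le {u : ℂ → ℂ} (hu : DecaysAboveCircle u) :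
    ∃ C c : ℝ, 0 < c ∧ 0 ≤ C ∧ ∀ θ ∈ Icc (0 : ℝ) Real.pi, ∀ s : ℝ, 0 ≤ s →
      ‖verticalPrimitive u (Complex.exp (θ * Complex.I) + s * Complex.I)‖ ≤
        C * Real.exp (-c * s) := by
  obtain ⟨C, c, hc, h⟩ := hu
  have hC : 0 ≤ C := by
    have := (norm_nonneg _).trans (h 0 ⟨le_rfl, Real.pi_pos.le⟩ 1 zero_le_one (by simp))
    exact nonneg_of_mul_nonneg_left this (Real.exp_pos _)
  refine ⟨C / c, c, hc, by positivity, fun θ hθ s hs => ?_⟩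
  refine (HaberlandPetersson.norm_verticalPrimitive_le (C := C * Real.exp (-c * s)) hc
    fun t ht => ?_).trans_eq (by ring)
  have h0 := Real.sin_nonneg_of_mem_Icc hθ
  have := h θ hθ (s + t) (by positivity) (by positivity)
  rw [mul_add, Real.exp_add, ← mul_assoc] at this
  convert this using 3
  push_cast
  ring

lemma intervalIntegrable_of_bounded {F : ℝ → ℂ} {a b C : ℝ} (hab : a ≤ b)
    (hF : AEStronglyMeasurable F (volume.restrict (Ioo a b))) (h : ∀ x ∈ Ioo a b, ‖F x‖ ≤ C) :
    IntervalIntegrable F volume a b := by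
  rw [intervalIntegrable_iff_integrableOn_Ioo_of_le hab]
  refine (integrableOn_const (C := C) measure_Ioo_lt_top.ne).mono' hF ?_
  filter_upwards [ae_restrict_mem measurableSet_Ioo] with x hx using h x hx

section

variable {u v : ℂ → ℂ}

lemma hasDerivAt_conj_mul_verticalPrimitive (hu : VerticallyDecaying u) (hv : VerticallyDecaying v)
    {p : ℝ → ℂ} {p' : ℂ} {x : ℝ} (hp : HasDerivAt p p' x) (hx : 0 < (p x).im) :
    HasDerivAt (fun x => conj (v (p x)) * verticalPrimitive u (p x))
      (conj (deriv v (p x) * p') * verticalPrimitive u (p x) + conj (v (p x)) * (u (p x) * p')) x := by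
  have h1 : HasDerivAt (fun x => v (p x)) (deriv v (p x) * p') x := by
    have := (hv.differentiableAt hx).hasDerivAt.scomp x hp
    rwa [smul_eq_mul, mul_comm] at this
  have h2 : HasDerivAt (fun x => verticalPrimitive u (p x)) (u (p x) * p') x := by
    have := (hu.hasDerivAt_verticalPrimitive hx).scomp x hp
    rwa [smul_eq_mul, mul_comm] at this
  have h3 : HasDerivAt (fun x => conj (v (p x))) (conj (deriv v (p x) * p')) x :=
    Complex.conjCLE.toContinuousLinearMap.hasFDerivAt.comp_hasDerivAt x h1
  exact h3.mul h2

lemma continuousOn_conj_mul_verticalPrimitive (hu : VerticallyDecaying u)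
    (hv : VerticallyDecaying v) :
    ContinuousOn (fun z => conj (v z) * verticalPrimitive u z) upperHalfPlaneSet :=
  (Complex.continuous_conj.comp_continuousOn hv.differentiableOn.continuousOn).mul
    hu.verticalPrimitive.differentiableOn.continuousOn

/-- The `θ`-derivative of the integral of `conj v * verticalPrimitive u` along the vertical ray
starting at `e^{iθ}`. -/
lemma hasDerivAt_integral_ray (hu : VerticallyDecaying u) (hv : VerticallyDecaying v)
    {θ : ℝ} (hθ : θ ∈ Ioo 0 Real.pi) :
    HasDerivAt (fun θ : ℝ => ∫ s in Ioi (0 : ℝ),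
        conj (v (Complex.exp (θ * Complex.I) + s * Complex.I)) *
          verticalPrimitive u (Complex.exp (θ * Complex.I) + s * Complex.I))
      (-(Complex.exp (-(θ * Complex.I)) * (conj (v (Complex.exp (θ * Complex.I))) *
          verticalPrimitive u (Complex.exp (θ * Complex.I)))) -
        2 * Real.sin θ * ∫ s in Ioi (0 : ℝ),
          conj (v (Complex.exp (θ * Complex.I) + s * Complex.I)) *
            u (Complex.exp (θ * Complex.I) + s * Complex.I)) θ := by
  have hsin : 0 < Real.sin θ := Real.sin_pos_of_mem_Ioo hθ
  set z : ℂ := Complex.exp (θ * Complex.I) with hz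
  have hzim : 0 < z.im := by rw [hz, exp_mul_I_im]; exact hsin
  obtain ⟨δ₁, C₁, c₁, hδ₁, hc₁, h₁⟩ := hv.decay z hzim
  obtain ⟨δ₂, C₂, c₂, hδ₂, hc₂, h₂⟩ := hv.deriv.decay z hzim
  obtain ⟨δ₃, C₃, c₃, hδ₃, hc₃, h₃⟩ := hu.decay z hzim
  obtain ⟨δ₄, C₄, c₄, hδ₄, hc₄, h₄⟩ := hu.verticalPrimitive.decay z hzim
  have hle : ∀ {C c t : ℝ} {x : ℂ}, 0 < c → 0 ≤ t → ‖x‖ ≤ C * Real.exp (-c * t) → ‖x‖ ≤ C := by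
    intro C c t x hc ht h
    have hC : 0 ≤ C := nonneg_of_mul_nonneg_left ((norm_nonneg _).trans h) (Real.exp_pos _)
    refine h.trans (mul_le_of_le_one_right hC ?_)
    rw [Real.exp_le_one_iff]
    nlinarith
  set N : Set ℝ := {θ' | Complex.exp (θ' * Complex.I) ∈ ball z δ₁ ∩ ball z δ₂ ∩ ball z δ₃ ∩ ball z δ₄ ∩
    upperHalfPlaneSet} with hN
  have hNn : N ∈ 𝓝 θ := by
    refine (Continuous.continuousAt (f := fun θ' : ℝ => Complex.exp (θ' * Complex.I))
      (by fun_prop)).preimage_mem_nhds ?_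
    exact inter_mem (inter_mem (inter_mem (inter_mem (ball_mem_nhds _ hδ₁) (ball_mem_nhds _ hδ₂))
      (ball_mem_nhds _ hδ₃)) (ball_mem_nhds _ hδ₄)) (isOpen_upperHalfPlaneSet.mem_nhds hzim)
  have hcont := continuousOn_conj_mul_verticalPrimitive hu hv
  have hcont' : ContinuousOn (fun w => conj (v w) * u w) upperHalfPlaneSet :=
    (Complex.continuous_conj.comp_continuousOn hv.differentiableOn.continuousOn).mul
      hu.differentiableOn.continuousOn
  have hpath : ∀ θ' s : ℝ, HasDerivAt (fun θ : ℝ => Complex.exp (θ * Complex.I) + s * Complex.I)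
      (Complex.I * Complex.exp (θ' * Complex.I)) θ' := fun θ' s =>
    (hasDerivAt_exp_mul_I θ').add_const _
  have int₁ : IntegrableOn (fun s : ℝ => conj (v (z + s * Complex.I)) *
      verticalPrimitive u (z + s * Complex.I)) (Ioi 0) := by
    refine (integrableOn_const_mul_exp (C₁ * C₄) hc₄).mono'
      (hcont.aestronglyMeasurable_vertical hzim.le) ?_
    filter_upwards [ae_restrict_mem measurableSet_Ioi] with s hs
    rw [norm_mul, RCLike.norm_conj, mul_assoc]
    have hs' : 0 ≤ s := le_of_lt hs
    have b1 := hle hc₁ hs' (h₁ z (mem_ball_self hδ₁) s hs')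
    exact mul_le_mul b1 (h₄ z (mem_ball_self hδ₄) s hs') (norm_nonneg _)
      ((norm_nonneg _).trans b1)
  have int₂ : IntegrableOn (fun s : ℝ => conj (v (z + s * Complex.I)) *
      u (z + s * Complex.I)) (Ioi 0) := by
    refine (integrableOn_const_mul_exp (C₁ * C₃) hc₃).mono'
      (hcont'.aestronglyMeasurable_vertical hzim.le) ?_
    filter_upwards [ae_restrict_mem measurableSet_Ioi] with s hs
    rw [norm_mul, RCLike.norm_conj, mul_assoc]
    have hs' : 0 ≤ s := le_of_lt hs
    have b1 := hle hc₁ hs' (h₁ z (mem_ball_self hδ₁) s hs')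
    exact mul_le_mul b1 (h₃ z (mem_ball_self hδ₃) s hs') (norm_nonneg _)
      ((norm_nonneg _).trans b1)
  have main := hasDerivAt_integral_of_dominated_loc_of_deriv_le (μ := volume.restrict (Ioi 0))
    (F := fun (θ s : ℝ) => conj (v (Complex.exp (θ * Complex.I) + s * Complex.I)) *
          verticalPrimitive u (Complex.exp (θ * Complex.I) + s * Complex.I))
    (F' := fun (θ s : ℝ) =>
      conj (deriv v (Complex.exp (θ * Complex.I) + s * Complex.I) *
          (Complex.I * Complex.exp (θ * Complex.I))) *
          verticalPrimitive u (Complex.exp (θ * Complex.I) + s * Complex.I) +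
      conj (v (Complex.exp (θ * Complex.I) + s * Complex.I)) *
        (u (Complex.exp (θ * Complex.I) + s * Complex.I) *
          (Complex.I * Complex.exp (θ * Complex.I))))
    (bound := fun s => C₂ * C₄ * Real.exp (-c₄ * s) + C₁ * C₃ * Real.exp (-c₃ * s)) hNn
    (by
      filter_upwards [hNn] with θ' hθ'
      exact hcont.aestronglyMeasurable_vertical (le_of_lt hθ'.2)) int₁
    (by
      refine ContinuousOn.aestronglyMeasurable ?_ measurableSet_Ioi
      refine ContinuousOn.add (ContinuousOn.mul ?_ ?_) (ContinuousOn.mul ?_ ?_)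
      · exact Complex.continuous_conj.comp_continuousOn
          ((hv.deriv.differentiableOn.continuousOn.comp_vertical hzim.le).mul continuousOn_const)
      · exact hu.verticalPrimitive.differentiableOn.continuousOn.comp_vertical hzim.le
      · exact Complex.continuous_conj.comp_continuousOn
          (hv.differentiableOn.continuousOn.comp_vertical hzim.le)
      · exact (hu.differentiableOn.continuousOn.comp_vertical hzim.le).mul continuousOn_const)
    (by
      filter_upwards [ae_restrict_mem measurableSet_Ioi] with s hs θ' hθ'
      obtain ⟨⟨⟨⟨m1, m2⟩, m3⟩, m4⟩, -⟩ := hθ'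
      have hs' : 0 ≤ s := le_of_lt hs
      have b1 := hle hc₁ hs' (h₁ _ m1 s hs')
      have b2 := hle hc₂ hs' (h₂ _ m2 s hs')
      refine (norm_add_le _ _).trans (add_le_add ?_ ?_)
      · rw [norm_mul, RCLike.norm_conj, norm_mul, norm_I_mul_exp_mul_I, mul_one, mul_assoc]
        exact mul_le_mul b2 (h₄ _ m4 s hs') (norm_nonneg _) ((norm_nonneg _).trans b2)
      · rw [norm_mul, RCLike.norm_conj, norm_mul, norm_I_mul_exp_mul_I, mul_one, mul_assoc]
        exact mul_le_mul b1 (h₃ _ m3 s hs') (norm_nonneg _) ((norm_nonneg _).trans b1))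
    ((integrableOn_const_mul_exp _ hc₄).add (integrableOn_const_mul_exp _ hc₃))
    (by
      filter_upwards [ae_restrict_mem measurableSet_Ioi] with s hs θ' hθ'
      exact hasDerivAt_conj_mul_verticalPrimitive hu hv (hpath θ' s)
        (add_mul_I_mem hθ'.2 (le_of_lt hs)))
  obtain ⟨int₃, main⟩ := main
  refine main.congr_deriv ?_
  simp only [← hz] at int₃ ⊢
  have hez : Complex.exp (-(θ * Complex.I)) = conj z := by
    rw [hz, ← Complex.exp_conj]; simp
  have hzz : conj z * z = 1 := by
    rw [hz, mul_comm, Complex.mul_conj, Complex.normSq_eq_norm_sq,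
      Complex.norm_exp_ofReal_mul_I]; simp
  -- The `θ`-derivative would be `z̄` times the `s`-derivative if the velocity `iz` in the
  -- holomorphic factor were `i z̄`. The discrepancy `iz - i z̄ = -2 sin θ` leaves exactly the area
  -- term, and the `s`-derivative integrates to a value on the circle.
  have hsum : Complex.I * z + conj (Complex.I * z) = -(2 * Real.sin θ) := by
    rw [Complex.add_conj, Complex.I_mul_re, hz, exp_mul_I_im]; push_cast; ring
  set S : ℝ → ℂ := fun s => conj (deriv v (z + s * Complex.I) * Complex.I) *
    verticalPrimitive u (z + s * Complex.I) +
      conj (v (z + s * Complex.I)) * (u (z + s * Complex.I) * Complex.I) with hS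
  have split : ∀ s : ℝ, conj (deriv v (z + s * Complex.I) * (Complex.I * z)) *
      verticalPrimitive u (z + s * Complex.I) +
        conj (v (z + s * Complex.I)) * (u (z + s * Complex.I) * (Complex.I * z)) =
      conj z * S s + (-(2 * Real.sin θ)) * (conj (v (z + s * Complex.I)) * u (z + s * Complex.I)) := by
    intro s
    rw [← hsum, hS]
    simp only [map_mul, Complex.conj_I]
    ring
  have intS : IntegrableOn S (Ioi 0) := by
    have : S = fun s : ℝ => z * ((conj (deriv v (z + s * Complex.I) * (Complex.I * z)) *
      verticalPrimitive u (z + s * Complex.I) +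
        conj (v (z + s * Complex.I)) * (u (z + s * Complex.I) * (Complex.I * z))) +
        (2 * Real.sin θ) * (conj (v (z + s * Complex.I)) * u (z + s * Complex.I))) := by
      funext s
      rw [split s]
      linear_combination -(S s) * hzz
    rw [this]
    exact (int₃.add (int₂.const_mul _)).const_mul z
  have ftc : ∫ s in Ioi (0 : ℝ), S s =
      0 - conj (v (z + (0 : ℝ) * Complex.I)) * verticalPrimitive u (z + (0 : ℝ) * Complex.I) := by
    refine integral_Ioi_of_hasDerivAt_of_tendsto'
      (f := fun s : ℝ => conj (v (z + s * Complex.I)) * verticalPrimitive u (z + s * Complex.I))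
      (fun s hs => ?_) intS ?_
    · have h1 : HasDerivAt (fun s : ℝ => z + s * Complex.I) Complex.I s := by
        simpa using ((Complex.ofRealCLM.hasDerivAt (x := s)).mul_const Complex.I).const_add z
      exact hasDerivAt_conj_mul_verticalPrimitive hu hv h1 (add_mul_I_mem hzim hs)
    · refine squeeze_zero_norm' ?_ (a := fun t => C₁ * (C₄ * Real.exp (-c₄ * t))) ?_
      · filter_upwards [eventually_ge_atTop 0] with s hs
        rw [norm_mul, RCLike.norm_conj]
        have b1 := hle hc₁ hs (h₁ z (mem_ball_self hδ₁) s hs)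
        exact mul_le_mul b1 (h₄ z (mem_ball_self hδ₄) s hs) (norm_nonneg _)
          ((norm_nonneg _).trans b1)
      · have : Tendsto (fun t : ℝ => -c₄ * t) atTop atBot :=
          tendsto_id.const_mul_atTop_of_neg (neg_lt_zero.mpr hc₄)
        simpa using ((Real.tendsto_exp_atBot.comp this).const_mul C₄).const_mul C₁
  simp only [split]
  rw [integral_add (intS.const_mul _) (int₂.const_mul _), integral_const_mul, integral_const_mul,
    ftc, hez]
  simp
  ring

/-- A common integrable majorant for the boundary and area integrands, independent of `θ`. -/
lemma DecaysAboveCircle.norm_conj_mul_le (hu' : DecaysAboveCircle u) (hv' : DecaysAboveCircle v) :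
    ∃ C c : ℝ, 0 < c ∧ ∀ θ ∈ Icc (0 : ℝ) Real.pi, ∀ s : ℝ, 0 ≤ s → 0 < Real.sin θ + s →
      ‖conj (v (Complex.exp (θ * Complex.I) + s * Complex.I)) *
        verticalPrimitive u (Complex.exp (θ * Complex.I) + s * Complex.I)‖ ≤
          C * Real.exp (-c * s) ∧
      ‖conj (v (Complex.exp (θ * Complex.I) + s * Complex.I)) *
        u (Complex.exp (θ * Complex.I) + s * Complex.I)‖ ≤ C * Real.exp (-c * s) := by
  obtain ⟨C₁, c₁, hc₁, hC₁, h₁⟩ := hu'.norm_verticalPrimitive_le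
  obtain ⟨C₂, c₂, hc₂, h₂⟩ := hu'
  obtain ⟨C₃, c₃, hc₃, h₃⟩ := hv'
  have hC₃ : 0 ≤ C₃ := by
    have := (norm_nonneg _).trans (h₃ 0 ⟨le_rfl, Real.pi_pos.le⟩ 1 zero_le_one (by simp))
    exact nonneg_of_mul_nonneg_left this (Real.exp_pos _)
  have hC₂ : 0 ≤ C₂ := by
    have := (norm_nonneg _).trans (h₂ 0 ⟨le_rfl, Real.pi_pos.le⟩ 1 zero_le_one (by simp))
    exact nonneg_of_mul_nonneg_left this (Real.exp_pos _)
  refine ⟨C₃ * max C₁ C₂, min c₁ c₂, lt_min hc₁ hc₂, fun θ hθ s hs hpos => ?_⟩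
  have b3 : ‖v (Complex.exp (θ * Complex.I) + s * Complex.I)‖ ≤ C₃ := by
    refine (h₃ θ hθ s hs hpos).trans (mul_le_of_le_one_right hC₃ ?_)
    rw [Real.exp_le_one_iff]
    nlinarith
  have e1 : Real.exp (-c₁ * s) ≤ Real.exp (-(min c₁ c₂) * s) :=
    Real.exp_le_exp.mpr (by nlinarith [min_le_left c₁ c₂])
  have e2 : Real.exp (-c₂ * s) ≤ Real.exp (-(min c₁ c₂) * s) :=
    Real.exp_le_exp.mpr (by nlinarith [min_le_right c₁ c₂])
  rw [norm_mul, norm_mul, RCLike.norm_conj, mul_assoc]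
  refine ⟨mul_le_mul b3 ((h₁ θ hθ s hs).trans ?_) (norm_nonneg _) hC₃,
    mul_le_mul b3 ((h₂ θ hθ s hs hpos).trans ?_) (norm_nonneg _) hC₃⟩
  · exact mul_le_mul (le_max_left _ _) e1 (Real.exp_pos _).le (by positivity)
  · exact mul_le_mul (le_max_right _ _) e2 (Real.exp_pos _).le (by positivity)

/-- Stokes' theorem on the region `|x| < 1`, `|τ| > 1` for the form
`conj (v τ) * verticalPrimitive u τ * d(conj τ)`. -/
lemma integral_ray_pi_sub_integral_ray_zero (hu : VerticallyDecaying u)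
    (hv : VerticallyDecaying v) (hu' : DecaysAboveCircle u) (hv' : DecaysAboveCircle v) :
    IntervalIntegrable (fun θ : ℝ => Complex.exp (-(θ * Complex.I)) *
      (conj (v (Complex.exp (θ * Complex.I))) *
        verticalPrimitive u (Complex.exp (θ * Complex.I)))) volume 0 Real.pi ∧
    IntervalIntegrable (fun θ : ℝ => 2 * Real.sin θ * ∫ s in Ioi (0 : ℝ),
          conj (v (Complex.exp (θ * Complex.I) + s * Complex.I)) *
            u (Complex.exp (θ * Complex.I) + s * Complex.I)) volume 0 Real.pi ∧
    (∫ s in Ioi (0 : ℝ), conj (v (-1 + s * Complex.I)) * verticalPrimitive u (-1 + s * Complex.I)) -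
      (∫ s in Ioi (0 : ℝ), conj (v (1 + s * Complex.I)) * verticalPrimitive u (1 + s * Complex.I)) =
    -(∫ θ in (0 : ℝ)..Real.pi, Complex.exp (-(θ * Complex.I)) *
      (conj (v (Complex.exp (θ * Complex.I))) *
        verticalPrimitive u (Complex.exp (θ * Complex.I)))) -
      ∫ θ in (0 : ℝ)..Real.pi, 2 * Real.sin θ * ∫ s in Ioi (0 : ℝ),
          conj (v (Complex.exp (θ * Complex.I) + s * Complex.I)) *
            u (Complex.exp (θ * Complex.I) + s * Complex.I) := by
  obtain ⟨C, c, hc, h⟩ := hu'.norm_conj_mul_le hv'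
  have hC : 0 ≤ C := by
    have := (norm_nonneg _).trans (h 0 ⟨le_rfl, Real.pi_pos.le⟩ 1 zero_le_one (by simp)).1
    exact nonneg_of_mul_nonneg_left this (Real.exp_pos _)
  have hcont := continuousOn_conj_mul_verticalPrimitive hu hv
  have hpath : ∀ s : ℝ, Continuous fun θ : ℝ => Complex.exp (θ * Complex.I) + s * Complex.I :=
    fun s => by fun_prop
  have him : ∀ θ s : ℝ, (Complex.exp (θ * Complex.I) + s * Complex.I).im = Real.sin θ + s :=
    fun θ s => by rw [im_add_mul_I, exp_mul_I_im]
  have hmem : ∀ θ ∈ Ioo 0 Real.pi, Complex.exp (θ * Complex.I) ∈ upperHalfPlaneSet := by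
    intro θ hθ
    show 0 < (Complex.exp (θ * Complex.I)).im
    rw [exp_mul_I_im]
    exact Real.sin_pos_of_mem_Ioo hθ
  set U : ℝ → ℂ := fun θ => ∫ s in Ioi (0 : ℝ),
        conj (v (Complex.exp (θ * Complex.I) + s * Complex.I)) *
          verticalPrimitive u (Complex.exp (θ * Complex.I) + s * Complex.I) with hU
  have hUc : ContinuousOn U (Icc 0 Real.pi) := by
    refine continuousOn_of_dominated (bound := fun s => C * Real.exp (-c * s)) ?_ ?_
      (integrableOn_const_mul_exp C hc) ?_
    · intro θ hθ
      refine hcont.aestronglyMeasurable_vertical ?_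
      rw [exp_mul_I_im]
      exact Real.sin_nonneg_of_mem_Icc hθ
    · intro θ hθ
      filter_upwards [ae_restrict_mem measurableSet_Ioi] with s hs
      have := Real.sin_nonneg_of_mem_Icc hθ
      exact (h θ hθ s (le_of_lt hs) (add_pos_of_nonneg_of_pos this hs)).1
    · filter_upwards [ae_restrict_mem measurableSet_Ioi] with s hs
      refine hcont.comp (hpath s).continuousOn fun θ hθ => ?_
      show 0 < (Complex.exp (θ * Complex.I) + s * Complex.I).im
      rw [him]
      exact add_pos_of_nonneg_of_pos (Real.sin_nonneg_of_mem_Icc hθ) hs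
  have int₁ : IntervalIntegrable (fun θ : ℝ => Complex.exp (-(θ * Complex.I)) *
      (conj (v (Complex.exp (θ * Complex.I))) *
        verticalPrimitive u (Complex.exp (θ * Complex.I)))) volume 0 Real.pi := by
    refine intervalIntegrable_of_bounded (C := C) Real.pi_pos.le ?_ fun θ hθ => ?_
    · refine ContinuousOn.aestronglyMeasurable ?_ measurableSet_Ioo
      refine ContinuousOn.mul (by fun_prop) ?_
      exact hcont.comp (f := fun θ : ℝ => Complex.exp (θ * Complex.I)) (by fun_prop) hmem
    · have e : Complex.exp (-(θ * Complex.I)) = Complex.exp ((-θ : ℝ) * Complex.I) := by simp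
      rw [e, norm_mul, Complex.norm_exp_ofReal_mul_I, one_mul]
      simpa using (h θ (Ioo_subset_Icc_self hθ) 0 le_rfl
        (by simpa using Real.sin_pos_of_mem_Ioo hθ)).1
  have hbd : ∀ θ ∈ Ioo 0 Real.pi, ‖2 * (Real.sin θ : ℂ) * ∫ s in Ioi (0 : ℝ),
          conj (v (Complex.exp (θ * Complex.I) + s * Complex.I)) *
            u (Complex.exp (θ * Complex.I) + s * Complex.I)‖ ≤ 2 * (C / c) := by
    intro θ hθ
    have b1 : ‖2 * (Real.sin θ : ℂ)‖ ≤ 2 := by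
      rw [norm_mul, Complex.norm_real]
      simpa using Real.abs_sin_le_one θ
    rw [norm_mul]
    refine mul_le_mul b1 ?_ (norm_nonneg _) (by norm_num)
    rw [← integral_const_mul_exp C hc]
    refine norm_integral_le_of_norm_le (integrableOn_const_mul_exp C hc) ?_
    filter_upwards [ae_restrict_mem measurableSet_Ioi] with s hs
    exact (h θ (Ioo_subset_Icc_self hθ) s (le_of_lt hs)
      (add_pos (Real.sin_pos_of_mem_Ioo hθ) hs)).2
  have int₂ : IntervalIntegrable (fun θ : ℝ => 2 * Real.sin θ * ∫ s in Ioi (0 : ℝ),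
          conj (v (Complex.exp (θ * Complex.I) + s * Complex.I)) *
            u (Complex.exp (θ * Complex.I) + s * Complex.I)) volume 0 Real.pi := by
    refine intervalIntegrable_of_bounded Real.pi_pos.le ?_ hbd
    -- Measurability in `θ` of the inner integral comes for free: by `hasDerivAt_integral_ray` the
    -- area term is minus the sum of the measurable arc term and of `deriv U`.
    have m₁ := ((intervalIntegrable_iff_integrableOn_Ioo_of_le Real.pi_pos.le).mp
      int₁).aestronglyMeasurable
    have m₂ : AEStronglyMeasurable (deriv U) (volume.restrict (Ioo 0 Real.pi)) :=
      (stronglyMeasurable_deriv U).aestronglyMeasurable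
    refine (m₁.add m₂).neg.congr ?_
    filter_upwards [ae_restrict_mem measurableSet_Ioo] with θ hθ
    have := (hasDerivAt_integral_ray hu hv hθ).deriv
    simp only [Pi.neg_apply, Pi.add_apply]
    rw [hU, this]
    ring
  refine ⟨int₁, int₂, ?_⟩
  -- The derivative exists only in the open interval, since the endpoints are cusps; continuity of
  -- `U` on the closed interval suffices.
  have ftc := intervalIntegral.integral_eq_sub_of_hasDerivAt_of_le Real.pi_pos.le hUc
    (fun θ hθ => hasDerivAt_integral_ray hu hv hθ) (int₁.neg.sub int₂)
  have hsub := intervalIntegral.integral_sub int₁.neg int₂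
  simp only [Pi.neg_apply] at hsub
  rw [hsub, intervalIntegral.integral_neg] at ftc
  rw [ftc, hU]
  simp

end

/-! ### Hyperbolic measure and coordinates on the triangle -/

lemma measurable_one_div_im_sq :
    Measurable fun z : ℍ => (1 / NNReal.mk z.im z.im_pos.le : NNReal) ^ 2 := by
  have h : Measurable fun z : ℍ => NNReal.mk z.im z.im_pos.le :=
    continuous_im.measurable.subtype_mk
  exact (measurable_const.div h).pow_const 2

lemma integrableOn_upperHalfPlane_iff {A : Set ℍ} (hA : MeasurableSet A) (F : ℂ → ℂ) :
    IntegrableOn (fun τ : ℍ => F τ) A ↔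
      IntegrableOn (fun z : ℂ => (1 / z.im ^ 2 : ℝ) • F z) (UpperHalfPlane.coe '' A) := by
  have mp : MeasurePreserving UpperHalfPlane.coe (volume.comap UpperHalfPlane.coe)
      (volume.restrict (.range UpperHalfPlane.coe)) :=
    ⟨measurable_coe, by rw [measurableEmbedding_coe.map_comap]⟩
  have hm := measurable_one_div_im_sq
  rw [IntegrableOn, volume_def, restrict_withDensity hA,
    integrable_withDensity_iff_integrable_smul hm, IntegrableOn,
    ← inter_eq_self_of_subset_left (image_subset_range UpperHalfPlane.coe A),
    ← Measure.restrict_restrict (measurableEmbedding_coe.measurableSet_image.mpr hA)]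
  change _ ↔ IntegrableOn _ _ _
  rw [mp.integrableOn_image measurableEmbedding_coe]
  simp only [IntegrableOn, Function.comp_def]
  refine integrable_congr (Eventually.of_forall fun τ => ?_)
  simp [NNReal.smul_def]

lemma setIntegral_upperHalfPlane {A : Set ℍ} (hA : MeasurableSet A) (F : ℂ → ℂ) :
    ∫ τ : ℍ in A, F τ = ∫ z in UpperHalfPlane.coe '' A, (1 / z.im ^ 2 : ℝ) • F z := by
  have mp : MeasurePreserving UpperHalfPlane.coe (volume.comap UpperHalfPlane.coe)
      (volume.restrict (.range UpperHalfPlane.coe)) :=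
    ⟨measurable_coe, by rw [measurableEmbedding_coe.map_comap]⟩
  have hm := measurable_one_div_im_sq
  rw [volume_def, restrict_withDensity hA,
    integral_withDensity_eq_integral_smul hm,
    ← inter_eq_self_of_subset_left (image_subset_range UpperHalfPlane.coe A),
    ← Measure.restrict_restrict (measurableEmbedding_coe.measurableSet_image.mpr hA),
    mp.setIntegral_image_emb measurableEmbedding_coe]
  refine integral_congr_ae (Eventually.of_forall fun τ => ?_)
  simp [NNReal.smul_def]

/-- The standard fundamental domain of the theta group: the ideal triangle with vertices
`-1`, `1`, `i∞`. -/
def thetaDomain : Set ℍ := {τ | |τ.re| < 1 ∧ 1 < Complex.normSq τ}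

lemma isOpen_thetaDomain : IsOpen thetaDomain := by
  refine .inter ?_ ?_
  · exact isOpen_lt (f := fun z : ℍ ↦ |z.re|) (by fun_prop) continuous_const
  · exact isOpen_lt continuous_const (Complex.continuous_normSq.comp continuous_coe)

/-- The parametrization `(θ, s) ↦ e^{iθ} + i s` in real coordinates. -/
noncomputable def circleRay (p : ℝ × ℝ) : ℝ × ℝ := (Real.cos p.1, Real.sin p.1 + p.2)

lemma hasFDerivAt_circleRay (p : ℝ × ℝ) :
    HasFDerivAt circleRay (Matrix.toLin (.finTwoProd ℝ) (.finTwoProd ℝ)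
      !![-Real.sin p.1, 0; Real.cos p.1, 1]).toContinuousLinearMap p := by
  rw [Matrix.toLin_finTwoProd_toContinuousLinearMap]
  convert! HasFDerivAt.prodMk (𝕜 := ℝ)
      ((Real.hasDerivAt_cos p.1).comp_hasFDerivAt p hasFDerivAt_fst)
      (((Real.hasDerivAt_sin p.1).comp_hasFDerivAt p hasFDerivAt_fst).add hasFDerivAt_snd) using 2
  · exact ContinuousLinearMap.ext fun q => by simp
  · simp

lemma injOn_circleRay : InjOn circleRay (Ioo 0 Real.pi ×ˢ Ioi 0) := by
  rintro ⟨θ, s⟩ ⟨hθ, hs⟩ ⟨θ', s'⟩ ⟨hθ', hs'⟩ h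
  simp only [circleRay, Prod.mk.injEq] at h
  have h1 : θ = θ' := Real.injOn_cos (Ioo_subset_Icc_self hθ) (Ioo_subset_Icc_self hθ') h.1
  subst h1
  simpa using h.2

/-- Each point lies above a unique point of the semicircle, at `θ = arccos x`. Being outside the
unit circle means being strictly higher than that point. -/
lemma coe_image_thetaDomain :
    UpperHalfPlane.coe '' thetaDomain =
      Complex.measurableEquivRealProd.symm '' (circleRay '' (Ioo 0 Real.pi ×ˢ Ioi 0)) := by
  ext z
  simp only [mem_image, Prod.exists, mem_prod, mem_Ioo, mem_Ioi]
  constructor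
  · rintro ⟨τ, ⟨h1, h2⟩, rfl⟩
    refine ⟨τ.re, τ.im, ⟨Real.arccos τ.re, τ.im - Real.sin (Real.arccos τ.re), ⟨?_, ?_⟩, ?_⟩, ?_⟩
    · have := abs_lt.mp h1
      exact ⟨Real.arccos_pos.mpr this.2, Real.arccos_lt_pi.mpr this.1⟩
    · rw [Real.sin_arccos, sub_pos, Real.sqrt_lt' τ.im_pos]
      rw [Complex.normSq_apply] at h2
      simp only [coe_re, coe_im] at h2
      nlinarith
    · have := abs_lt.mp h1
      simp [circleRay, Real.cos_arccos this.1.le this.2.le]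
    · apply Complex.ext <;> simp [Complex.measurableEquivRealProd]
  · rintro ⟨x, y, ⟨θ, s, ⟨hθ, hs⟩, h⟩, rfl⟩
    have hsin : 0 < Real.sin θ := Real.sin_pos_of_mem_Ioo hθ
    simp only [circleRay, Prod.mk.injEq] at h
    obtain ⟨rfl, rfl⟩ := h
    have hsq := Real.sin_sq_add_cos_sq θ
    refine ⟨⟨⟨Real.cos θ, Real.sin θ + s⟩, by simpa using by positivity⟩, ⟨?_, ?_⟩, ?_⟩
    · show |Real.cos θ| < 1
      rw [← sq_lt_one_iff_abs_lt_one]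
      nlinarith
    · rw [Complex.normSq_apply]
      simp only
      nlinarith
    · apply Complex.ext <;> simp [Complex.measurableEquivRealProd]

lemma measurableEquivRealProd_symm_circleRay (p : ℝ × ℝ) :
    Complex.measurableEquivRealProd.symm (circleRay p) =
      Complex.exp (p.1 * Complex.I) + p.2 * Complex.I := by
  rw [Complex.exp_mul_I]
  apply Complex.ext <;> simp [Complex.measurableEquivRealProd, circleRay, ← Complex.ofReal_cos,
    ← Complex.ofReal_sin]

/-- Integration over the theta domain in the coordinates `(θ, s) ↦ e^{iθ} + i s`. -/
lemma integral_coe_image_thetaDomain {G : ℂ → ℂ} (hG : ContinuousOn G upperHalfPlaneSet)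
    {C c : ℝ} (hc : 0 < c) (h : ∀ θ ∈ Icc (0 : ℝ) Real.pi, ∀ s : ℝ, 0 ≤ s → 0 < Real.sin θ + s →
      ‖G (Complex.exp (θ * Complex.I) + s * Complex.I)‖ ≤ C * Real.exp (-c * s)) :
    IntegrableOn G (UpperHalfPlane.coe '' thetaDomain) ∧
      ∫ z in UpperHalfPlane.coe '' thetaDomain, G z =
        ∫ θ in (0 : ℝ)..Real.pi, Real.sin θ *
          ∫ s in Ioi (0 : ℝ), G (Complex.exp (θ * Complex.I) + s * Complex.I) := by
  have mp := Complex.volume_preserving_equiv_real_prod.symm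
  have me := Complex.measurableEquivRealProd.symm.measurableEmbedding
  have hms : MeasurableSet (Ioo (0 : ℝ) Real.pi ×ˢ Ioi (0 : ℝ)) :=
    measurableSet_Ioo.prod measurableSet_Ioi
  have hdet : ∀ p : ℝ × ℝ, |((Matrix.toLin (.finTwoProd ℝ) (.finTwoProd ℝ)
      !![-Real.sin p.1, 0; Real.cos p.1, 1]).toContinuousLinearMap).det| = |Real.sin p.1| := by
    intro p
    simp [LinearMap.det_toContinuousLinearMap, LinearMap.det_toLin, Matrix.det_fin_two_of]
  have hint : IntegrableOn (fun p : ℝ × ℝ => |Real.sin p.1| •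
      G (Complex.exp (p.1 * Complex.I) + p.2 * Complex.I)) (Ioo (0 : ℝ) Real.pi ×ˢ Ioi (0 : ℝ)) := by
    have hb : IntegrableOn (fun p : ℝ × ℝ => (1 : ℝ) * (C * Real.exp (-c * p.2)))
        (Ioo (0 : ℝ) Real.pi ×ˢ Ioi (0 : ℝ)) := by
      rw [IntegrableOn, Measure.volume_eq_prod, ← Measure.prod_restrict]
      exact Integrable.mul_prod (f := fun _ : ℝ => (1 : ℝ))
        (g := fun s : ℝ => C * Real.exp (-c * s))
        (integrableOn_const measure_Ioo_lt_top.ne) (integrableOn_const_mul_exp C hc)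
    refine hb.mono' (ContinuousOn.aestronglyMeasurable ?_ hms) ?_
    · have c₁ : Continuous fun p : ℝ × ℝ => |Real.sin p.1| := by fun_prop
      have c₂ : Continuous fun p : ℝ × ℝ =>
        Complex.exp (p.1 * Complex.I) + p.2 * Complex.I := by fun_prop
      refine c₁.continuousOn.smul (hG.comp c₂.continuousOn ?_)
      rintro ⟨θ, s⟩ ⟨hθ, hs⟩
      show 0 < (Complex.exp (θ * Complex.I) + s * Complex.I).im
      rw [im_add_mul_I, exp_mul_I_im]
      exact add_pos (Real.sin_pos_of_mem_Ioo hθ) hs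
    · filter_upwards [ae_restrict_mem hms] with ⟨θ, s⟩ ⟨hθ, hs⟩
      rw [norm_smul]
      refine mul_le_mul ?_ (h θ (Ioo_subset_Icc_self hθ) s (le_of_lt hs)
        (add_pos (Real.sin_pos_of_mem_Ioo hθ) hs)) (norm_nonneg _) zero_le_one
      simpa using Real.abs_sin_le_one θ
  rw [coe_image_thetaDomain]
  constructor
  · rw [mp.integrableOn_image me, integrableOn_image_iff_integrableOn_abs_det_fderiv_smul volume hms
      (fun p _ => (hasFDerivAt_circleRay p).hasFDerivWithinAt) injOn_circleRay]
    simpa only [hdet, Function.comp_apply, measurableEquivRealProd_symm_circleRay] using hint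
  · rw [mp.setIntegral_image_emb me, integral_image_eq_integral_abs_det_fderiv_smul volume hms
      (fun p _ => (hasFDerivAt_circleRay p).hasFDerivWithinAt) injOn_circleRay]
    simp only [hdet, measurableEquivRealProd_symm_circleRay]
    rw [Measure.volume_eq_prod] at hint ⊢
    rw [setIntegral_prod _ hint, intervalIntegral.integral_of_le Real.pi_pos.le,
      integral_Ioc_eq_integral_Ioo]
    refine setIntegral_congr_fun measurableSet_Ioo fun θ hθ => ?_
    simp only
    rw [integral_smul, abs_of_pos (Real.sin_pos_of_mem_Ioo hθ), Complex.real_smul]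

/-! ### Null sets, and the triangle as three modular domains -/

lemma measurePreserving_SL_smul (g : SL(2, ℤ)) :
    MeasurePreserving (fun τ : ℍ => g • τ) volume volume :=
  measurePreserving_smul (g : GL (Fin 2) ℝ) (volume : Measure ℍ)

lemma measurableEmbedding_SL_smul (g : SL(2, ℤ)) : MeasurableEmbedding (fun τ : ℍ => g • τ) :=
  measurableEmbedding_const_smul (g : GL (Fin 2) ℝ)

lemma volume_eq_zero_of_coe_image {s : Set ℍ} (h : volume (UpperHalfPlane.coe '' s) = 0) :
    volume s = 0 := by
  rw [volume_eq_lintegral]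
  exact setLIntegral_measure_zero _ _ h

lemma volume_re_eq (a : ℝ) : volume {τ : ℍ | τ.re = a} = 0 := by
  refine volume_eq_zero_of_coe_image (measure_mono_null (t := {z : ℂ | z.re = a}) ?_ ?_)
  · rintro _ ⟨τ, h, rfl⟩
    exact h
  · have : {z : ℂ | z.re = a} = Complex.measurableEquivRealProd ⁻¹' ({a} ×ˢ univ) := by
      ext z
      simp [Complex.measurableEquivRealProd]
    rw [this, Complex.volume_preserving_equiv_real_prod.measure_preimage
      ((measurableSet_singleton a).prod MeasurableSet.univ).nullMeasurableSet,
      Measure.volume_eq_prod, Measure.prod_prod]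
    simp

lemma volume_circle_eq (a : ℝ) : volume {τ : ℍ | (τ.re - a) ^ 2 + τ.im ^ 2 = 1} = 0 := by
  refine volume_eq_zero_of_coe_image (measure_mono_null (t := sphere (a : ℂ) 1) ?_
    (Measure.addHaar_sphere _ _ _))
  rintro _ ⟨τ, h, rfl⟩
  rw [mem_sphere, dist_eq_norm, ← sq_eq_sq₀ (norm_nonneg _) zero_le_one,
    ← Complex.normSq_eq_norm_sq, Complex.normSq_apply]
  simp only [mem_ofPred_eq] at h
  simp
  linarith

lemma normSq_coe (τ : ℍ) : Complex.normSq τ = τ.re ^ 2 + τ.im ^ 2 := by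
  rw [Complex.normSq_apply]
  simp [sq]

lemma volume_fd_diff_fdo : volume (𝒟 \ 𝒟ᵒ) = 0 := by
  refine measure_mono_null (t := {τ : ℍ | τ.re = 1 / 2} ∪ {τ : ℍ | τ.re = -(1 / 2)} ∪
    {τ : ℍ | (τ.re - 0) ^ 2 + τ.im ^ 2 = 1}) ?_ ?_
  · rintro τ ⟨⟨h1, h2⟩, h3⟩
    rw [normSq_coe] at h1
    simp only [mem_union, mem_ofPred_eq, sub_zero]
    by_contra! hcon
    obtain ⟨⟨h4, h5⟩, h6⟩ := hcon
    refine h3 ⟨?_, ?_⟩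
    · rw [normSq_coe]
      exact lt_of_le_of_ne h1 (Ne.symm h6)
    · refine lt_of_le_of_ne h2 fun h => ?_
      rcases (abs_eq (by norm_num)).mp h with h | h
      · exact h4 h
      · exact h5 h
  · exact measure_union_null (measure_union_null (volume_re_eq _) (volume_re_eq _))
      (volume_circle_eq _)

lemma fd_ae_eq_fdo : (𝒟 : Set ℍ) =ᵐ[volume] 𝒟ᵒ := by
  refine (ae_eq_set.mpr ⟨volume_fd_diff_fdo, ?_⟩)
  rw [sdiff_eq_empty.mpr fdo_subset_fd, measure_empty]

/-- A translate of the standard fundamental domain meets it in a null set. -/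
lemma volume_fd_inter_smul_fd {g : SL(2, ℤ)} (h1 : g ≠ 1) (h2 : g ≠ -1) :
    volume ((fun τ : ℍ => g • τ) ⁻¹' 𝒟 ∩ 𝒟) = 0 := by
  refine measure_mono_null ?_ volume_fd_diff_fdo
  rintro τ ⟨hg, hτ⟩
  refine ⟨hτ, fun ho => ?_⟩
  rcases eq_one_or_neg_one_of_mem_fdo_mem_fd ho hg with h | h
  exacts [h1 h, h2 h]

lemma re_S_smul (τ : ℍ) : (S • τ).re = -τ.re / (τ.re ^ 2 + τ.im ^ 2) := by
  rw [← coe_re, modular_S_smul, coe_mk, Complex.inv_re, Complex.normSq_neg, normSq_coe]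
  simp

lemma im_S_smul (τ : ℍ) : (S • τ).im = τ.im / (τ.re ^ 2 + τ.im ^ 2) := by
  rw [← coe_im, modular_S_smul, coe_mk, Complex.inv_im, Complex.normSq_neg, normSq_coe]
  simp

section

variable {Φ : ℍ → ℂ}

lemma setIntegral_preimage_SL (hΦ : ∀ (g : SL(2, ℤ)) τ, Φ (g • τ) = Φ τ) (g : SL(2, ℤ))
    (A : Set ℍ) : ∫ τ in (fun τ : ℍ => g • τ) ⁻¹' A, Φ τ = ∫ τ in A, Φ τ := by
  have h := (measurePreserving_SL_smul g).setIntegral_preimage_emb (measurableEmbedding_SL_smul g)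
    Φ A
  simpa only [hΦ] using h

/-- The theta domain consists of three copies of the modular fundamental domain. -/
lemma setIntegral_thetaDomain (hΦ : ∀ (g : SL(2, ℤ)) τ, Φ (g • τ) = Φ τ)
    (hint : IntegrableOn Φ thetaDomain) :
    ∫ τ in thetaDomain, Φ τ = 3 * ∫ τ in 𝒟, Φ τ := by
  have mre : Measurable fun τ : ℍ => τ.re := (continuous_re).measurable
  have mim : Measurable fun τ : ℍ => τ.im := (continuous_im).measurable
  -- `Fp` and `Fm` are the right and left halves of the standard domain. The other pieces are their
  -- translates: `A₁ = T Fm`, `B₁ = T⁻¹ Fp`, `A₂ = (S T⁻¹)⁻¹ Fp`, `B₂ = (S T)⁻¹ Fm`, so each half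
  -- occurs three times in the triangle.
  set Fp : Set ℍ := {τ | 0 < τ.re ∧ τ.re < 1 / 2 ∧ 1 < τ.re ^ 2 + τ.im ^ 2} with hFp
  set Fm : Set ℍ := {τ | -(1 / 2) < τ.re ∧ τ.re < 0 ∧ 1 < τ.re ^ 2 + τ.im ^ 2} with hFm
  set A₁ : Set ℍ := {τ | 1 / 2 < τ.re ∧ τ.re < 1 ∧ 1 < (τ.re - 1) ^ 2 + τ.im ^ 2} with hA₁
  set A₂ : Set ℍ := {τ | τ.re < 1 ∧ (τ.re - 1) ^ 2 + τ.im ^ 2 < 1 ∧ 1 < τ.re ^ 2 + τ.im ^ 2}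
    with hA₂
  set B₁ : Set ℍ := {τ | τ.re < -(1 / 2) ∧ -1 < τ.re ∧ 1 < (τ.re - -1) ^ 2 + τ.im ^ 2} with hB₁
  set B₂ : Set ℍ := {τ | -1 < τ.re ∧ (τ.re - -1) ^ 2 + τ.im ^ 2 < 1 ∧ 1 < τ.re ^ 2 + τ.im ^ 2}
    with hB₂
  have mFp : MeasurableSet Fp := by measurability
  have mFm : MeasurableSet Fm := by measurability
  have mA₁ : MeasurableSet A₁ := by measurability
  have mA₂ : MeasurableSet A₂ := by measurability
  have mB₁ : MeasurableSet B₁ := by measurability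
  have mB₂ : MeasurableSet B₂ := by measurability
  have hmemR : ∀ τ : ℍ, τ ∈ thetaDomain ↔
      (-1 < τ.re ∧ τ.re < 1) ∧ 1 < τ.re ^ 2 + τ.im ^ 2 := fun τ => by
    rw [← normSq_coe, ← abs_lt]
    rfl
  have hae : thetaDomain =ᵐ[volume] (((((Fp ∪ Fm) ∪ A₁) ∪ A₂) ∪ B₁) ∪ B₂ : Set ℍ) := by
    refine ae_eq_set.mpr ⟨?_, ?_⟩
    · refine measure_mono_null (t := ((({τ : ℍ | τ.re = 0} ∪ {τ : ℍ | τ.re = 1 / 2}) ∪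
        {τ : ℍ | τ.re = -(1 / 2)}) ∪ {τ : ℍ | (τ.re - (1 : ℝ)) ^ 2 + τ.im ^ 2 = 1}) ∪
        {τ : ℍ | (τ.re - (-1 : ℝ)) ^ 2 + τ.im ^ 2 = 1}) ?_
        (measure_union_null (measure_union_null (measure_union_null (measure_union_null
          (volume_re_eq _) (volume_re_eq _)) (volume_re_eq _)) (volume_circle_eq _))
          (volume_circle_eq _))
      rintro τ ⟨h1, h2⟩
      obtain ⟨⟨h3, h4⟩, h5⟩ := (hmemR τ).mp h1
      by_contra hcon
      refine h2 ?_
      simp only [mem_union, mem_ofPred_eq, not_or] at hcon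
      obtain ⟨⟨⟨⟨n1, n2⟩, n3⟩, n4⟩, n5⟩ := hcon
      simp only [mem_union, hFp, hFm, hA₁, hA₂, hB₁, hB₂, mem_ofPred_eq]
      rcases lt_or_gt_of_ne n1 with g1 | g1
      · rcases lt_or_gt_of_ne n3 with g3 | g3
        · rcases lt_or_gt_of_ne n5 with g5 | g5
          · exact Or.inr ⟨h3, g5, h5⟩
          · exact Or.inl (Or.inr ⟨g3, h3, g5⟩)
        · exact Or.inl (Or.inl (Or.inl (Or.inl (Or.inr ⟨g3, g1, h5⟩))))
      · rcases lt_or_gt_of_ne n2 with g2 | g2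
        · exact Or.inl (Or.inl (Or.inl (Or.inl (Or.inl ⟨g1, g2, h5⟩))))
        · rcases lt_or_gt_of_ne n4 with g4 | g4
          · exact Or.inl (Or.inl (Or.inr ⟨h4, g4, h5⟩))
          · exact Or.inl (Or.inl (Or.inl (Or.inr ⟨g2, h4, g4⟩)))
    · rw [sdiff_eq_empty.mpr, measure_empty]
      rintro τ (((((⟨h1, h2, h3⟩ | ⟨h1, h2, h3⟩) | ⟨h1, h2, h3⟩) | ⟨h1, h2, h3⟩) | ⟨h1, h2, h3⟩)
        | ⟨h1, h2, h3⟩) <;> refine (hmemR τ).mpr ⟨⟨?_, ?_⟩, ?_⟩ <;> nlinarith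
  have eA₁ : ∫ τ in A₁, Φ τ = ∫ τ in Fm, Φ τ := by
    rw [← setIntegral_preimage_SL hΦ T⁻¹ Fm]
    congr 2
    ext τ
    simp only [hA₁, hFm, mem_preimage, mem_ofPred_eq, re_T_inv_smul, im_T_inv_smul]
    constructor <;> rintro ⟨h1, h2, h3⟩ <;> refine ⟨?_, ?_, ?_⟩ <;> linarith
  have eB₁ : ∫ τ in B₁, Φ τ = ∫ τ in Fp, Φ τ := by
    rw [← setIntegral_preimage_SL hΦ T Fp]
    congr 2
    ext τ
    simp only [hB₁, hFp, mem_preimage, mem_ofPred_eq, re_T_smul, im_T_smul]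
    constructor <;> rintro ⟨h1, h2, h3⟩ <;> refine ⟨?_, ?_, ?_⟩ <;> linarith
  have key : ∀ τ : ℍ, (S • τ).re ^ 2 + (S • τ).im ^ 2 = 1 / (τ.re ^ 2 + τ.im ^ 2) := by
    intro τ
    have := τ.im_pos
    rw [re_S_smul, im_S_smul]
    field_simp
  have eA₂ : ∫ τ in A₂, Φ τ = ∫ τ in Fp, Φ τ := by
    rw [← setIntegral_preimage_SL hΦ (S * T⁻¹) Fp]
    congr 2
    ext τ
    have him := τ.im_pos
    have hpos : 0 < (τ.re - 1) ^ 2 + τ.im ^ 2 := by positivity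
    simp only [hA₂, hFp, mem_preimage, mem_ofPred_eq, mul_smul, key]
    simp only [re_S_smul, re_T_inv_smul, im_T_inv_smul]
    rw [lt_div_iff₀ hpos, div_lt_iff₀ hpos, lt_div_iff₀ hpos]
    constructor <;> rintro ⟨h1, h2, h3⟩ <;> refine ⟨?_, ?_, ?_⟩ <;> nlinarith
  have eB₂ : ∫ τ in B₂, Φ τ = ∫ τ in Fm, Φ τ := by
    rw [← setIntegral_preimage_SL hΦ (S * T) Fm]
    congr 2
    ext τ
    have him := τ.im_pos
    have hpos : 0 < (τ.re + 1) ^ 2 + τ.im ^ 2 := by positivity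
    simp only [hB₂, hFm, mem_preimage, mem_ofPred_eq, mul_smul, key]
    simp only [re_S_smul, re_T_smul, im_T_smul]
    rw [lt_div_iff₀ hpos, div_lt_iff₀ hpos, lt_div_iff₀ hpos]
    constructor <;> rintro ⟨h1, h2, h3⟩ <;> refine ⟨?_, ?_, ?_⟩ <;> nlinarith
  have hfd : ∫ τ in 𝒟, Φ τ = ∫ τ in Fp ∪ Fm, Φ τ := by
    rw [setIntegral_congr_set fd_ae_eq_fdo]
    refine setIntegral_congr_set (ae_eq_set.mpr ⟨?_, ?_⟩)
    · refine measure_mono_null ?_ (volume_re_eq 0)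
      rintro τ ⟨⟨h1, h2⟩, h3⟩
      rw [normSq_coe] at h1
      rw [abs_lt] at h2
      by_contra hcon
      rcases lt_or_gt_of_ne hcon with g | g
      · exact h3 (Or.inr ⟨h2.1, g, h1⟩)
      · exact h3 (Or.inl ⟨g, h2.2, h1⟩)
    · rw [sdiff_eq_empty.mpr, measure_empty]
      rintro τ (⟨h1, h2, h3⟩ | ⟨h1, h2, h3⟩) <;>
        exact ⟨by rwa [normSq_coe], abs_lt.mpr ⟨by linarith, by linarith⟩⟩
  have hU : IntegrableOn Φ (((((Fp ∪ Fm) ∪ A₁) ∪ A₂) ∪ B₁) ∪ B₂) :=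
    hint.congr_set_ae hae.symm
  simp only [integrableOn_union] at hU
  obtain ⟨⟨⟨⟨⟨i1, i2⟩, i3⟩, i4⟩, i5⟩, i6⟩ := hU
  have d1 : Disjoint Fp Fm := by
    rw [Set.disjoint_left]; rintro τ ⟨h1, h2, h3⟩ ⟨h4, h5, h6⟩; linarith
  have d2 : Disjoint (Fp ∪ Fm) A₁ := by
    rw [Set.disjoint_left]
    rintro τ (⟨h1, h2, h3⟩ | ⟨h1, h2, h3⟩) ⟨h4, h5, h6⟩ <;> linarith
  have d3 : Disjoint ((Fp ∪ Fm) ∪ A₁) A₂ := by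
    rw [Set.disjoint_left]
    rintro τ ((⟨h1, h2, h3⟩ | ⟨h1, h2, h3⟩) | ⟨h1, h2, h3⟩) ⟨h4, h5, h6⟩ <;> nlinarith
  have d4 : Disjoint (((Fp ∪ Fm) ∪ A₁) ∪ A₂) B₁ := by
    rw [Set.disjoint_left]
    rintro τ (((⟨h1, h2, h3⟩ | ⟨h1, h2, h3⟩) | ⟨h1, h2, h3⟩) | ⟨h1, h2, h3⟩) ⟨h4, h5, h6⟩ <;>
      nlinarith
  have d5 : Disjoint ((((Fp ∪ Fm) ∪ A₁) ∪ A₂) ∪ B₁) B₂ := by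
    rw [Set.disjoint_left]
    rintro τ ((((⟨h1, h2, h3⟩ | ⟨h1, h2, h3⟩) | ⟨h1, h2, h3⟩) | ⟨h1, h2, h3⟩) | ⟨h1, h2, h3⟩)
      ⟨h4, h5, h6⟩ <;> nlinarith
  rw [hfd, setIntegral_congr_set hae,
    setIntegral_union d5 mB₂ ((((i1.union i2).union i3).union i4).union i5) i6,
    setIntegral_union d4 mB₁ (((i1.union i2).union i3).union i4) i5,
    setIntegral_union d3 mA₂ ((i1.union i2).union i3) i4,
    setIntegral_union d2 mA₁ (i1.union i2) i3,
    setIntegral_union d1 mFm i1 i2, eA₁, eA₂, eB₁, eB₂]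
  ring

end

/-! ### Cosets and fundamental domains of `Γ₀(N)` -/

namespace IsRightCosetDecomposition

variable {N r : ℕ} {γ : Fin r → SL(2, ℤ)}

lemma exists_eq_mul (hγ : IsRightCosetDecomposition N γ) (δ : SL(2, ℤ)) :
    ∃ j, ∃ α ∈ Gamma0 N, δ = α * γ j := by
  have : δ ∈ (⋃ j, {δ : SL(2, ℤ) | ∃ α ∈ Gamma0 N, δ = α * γ j}) := by rw [hγ.1]; trivial
  simpa using this

lemma eq_of_eq_mul (hγ : IsRightCosetDecomposition N γ) {i j : Fin r} {α β : SL(2, ℤ)}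
    (hα : α ∈ Gamma0 N) (hβ : β ∈ Gamma0 N) (h : α * γ i = β * γ j) : i = j := by
  by_contra hij
  exact Set.disjoint_left.mp (hγ.2 hij) ⟨α, hα, rfl⟩ ⟨β, hβ, h⟩

/-- Inversion turns right cosets into the left cosets that `Subgroup.index` counts. -/
lemma index_eq (hγ : IsRightCosetDecomposition N γ) : (Gamma0 N).index = r := by
  have hb : Function.Bijective fun j : Fin r => (((γ j)⁻¹ : SL(2, ℤ)) : SL(2, ℤ) ⧸ Gamma0 N) := by
    constructor
    · intro i j h
      have h1 := QuotientGroup.eq.mp h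
      rw [inv_inv] at h1
      exact hγ.eq_of_eq_mul (Subgroup.one_mem _) h1 (by group)
    · intro q
      obtain ⟨δ, rfl⟩ := QuotientGroup.mk_surjective q
      obtain ⟨j, α, hα, h⟩ := hγ.exists_eq_mul δ⁻¹
      refine ⟨j, QuotientGroup.eq.mpr ?_⟩
      have : (γ j)⁻¹⁻¹ * δ = α⁻¹ := by
        rw [inv_inv, eq_comm, inv_eq_iff_eq_inv, mul_inv_rev, h]
        group
      rw [this]
      exact inv_mem hα
  rw [Subgroup.index, ← Nat.card_congr (Equiv.ofBijective _ hb), Nat.card_fin]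

/-- Right translation permutes the right cosets. -/
lemma exists_perm (hγ : IsRightCosetDecomposition N γ) (δ : SL(2, ℤ)) :
    ∃ σ : Equiv.Perm (Fin r), ∀ j, ∃ α ∈ Gamma0 N, γ j * δ = α * γ (σ j) := by
  choose s hs using fun j => hγ.exists_eq_mul (γ j * δ)
  have hinj : Function.Injective s := by
    intro i j hij
    obtain ⟨α, hα, h1⟩ := hs i
    obtain ⟨β, hβ, h2⟩ := hs j
    rw [← hij] at h2
    refine hγ.eq_of_eq_mul (inv_mem hα) (inv_mem hβ) (mul_right_cancel (b := δ) ?_)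
    rw [mul_assoc, mul_assoc, h1, h2]
    group
  exact ⟨Equiv.ofBijective s (Finite.injective_iff_bijective.mp hinj), hs⟩

end IsRightCosetDecomposition

/-- The union of the translates `γ j • 𝒟` of the standard fundamental domain. -/
def unionTranslates {r : ℕ} (γ : Fin r → SL(2, ℤ)) : Set ℍ :=
  ⋃ j, (fun τ : ℍ => (γ j)⁻¹ • τ) ⁻¹' 𝒟

section

variable {N r : ℕ} {γ : Fin r → SL(2, ℤ)}

lemma measurableSet_translate (g : SL(2, ℤ)) :
    MeasurableSet ((fun τ : ℍ => g • τ) ⁻¹' 𝒟) :=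
  (measurableEmbedding_SL_smul g).measurable isClosed_fd.measurableSet

/-- Translates of the standard fundamental domain by elements which differ by more than a sign
meet in a null set. -/
lemma volume_inter_translates {g h : SL(2, ℤ)} (h1 : g ≠ h) (h2 : g ≠ -h) :
    volume ((fun τ : ℍ => g • τ) ⁻¹' 𝒟 ∩ (fun τ : ℍ => h • τ) ⁻¹' 𝒟) = 0 := by
  have n1 : g * h⁻¹ ≠ 1 := fun e => h1 (mul_inv_eq_one.mp e)
  have n2 : g * h⁻¹ ≠ -1 := fun e => h2 (by
    have := congrArg (· * h) e
    simpa using this)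
  have e : (fun τ : ℍ => g • τ) ⁻¹' 𝒟 ∩ (fun τ : ℍ => h • τ) ⁻¹' 𝒟 =
      (fun τ : ℍ => h • τ) ⁻¹' ((fun τ : ℍ => (g * h⁻¹) • τ) ⁻¹' 𝒟 ∩ 𝒟) := by
    ext τ
    simp only [mem_inter_iff, mem_preimage, smul_smul, inv_mul_cancel_right]
  rw [e, (measurePreserving_SL_smul h).measure_preimage
    ((measurableSet_translate _).inter isClosed_fd.measurableSet).nullMeasurableSet]
  exact volume_fd_inter_smul_fd n1 n2

lemma neg_one_mem_Gamma0 : (-1 : SL(2, ℤ)) ∈ Gamma0 N := by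
  simp [Gamma0_mem]

/-- If `δ` moves `τ` into the standard domain, writing `δ⁻¹ = α γ_j` shows that `α⁻¹ τ` lies in `γ_j
𝒟`. Overlaps are null because two translates of `𝒟` meet in positive measure only when their
matrices agree up to sign. -/
lemma isGamma0FundamentalDomain_unionTranslates (hγ : IsRightCosetDecomposition N γ) :
    IsGamma0FundamentalDomain N (unionTranslates γ) := by
  have hmp : ∀ g : gamma0Transformations N,
      MeasurePreserving (fun τ : ℍ => g • τ) volume volume := by
    rintro ⟨g, α, hα, rfl⟩
    exact measurePreserving_SL_smul α
  refine IsFundamentalDomain.mk'' ?_ ?_ ?_ fun g => (hmp g).quasiMeasurePreserving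
  · exact (MeasurableSet.iUnion fun j => measurableSet_translate _).nullMeasurableSet
  · refine Eventually.of_forall fun τ => ?_
    obtain ⟨δ, hδ⟩ := exists_smul_mem_fd τ
    obtain ⟨j, α, hα, h⟩ := hγ.exists_eq_mul δ⁻¹
    refine ⟨⟨_, α⁻¹, inv_mem hα, rfl⟩, mem_iUnion.mpr ⟨j, ?_⟩⟩
    show (γ j)⁻¹ • (α⁻¹ • τ) ∈ 𝒟
    rwa [smul_smul, ← mul_inv_rev, ← h, inv_inv]
  · rintro ⟨g, α, hα, rfl⟩ hne
    have hsm : ((⟨MulAction.toPermHom SL(2, ℤ) ℍ α, α, hα, rfl⟩ : gamma0Transformations N) •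
        unionTranslates γ) = ⋃ j, (fun τ : ℍ => (α * γ j)⁻¹ • τ) ⁻¹' 𝒟 := by
      ext τ
      rw [mem_smul_set_iff_inv_smul_mem]
      show α⁻¹ • τ ∈ unionTranslates γ ↔ _
      simp only [unionTranslates, mem_iUnion, mem_preimage, smul_smul, mul_inv_rev]
    rw [hsm, AEDisjoint, unionTranslates, iUnion_inter]
    refine measure_iUnion_null fun i => ?_
    rw [inter_iUnion]
    refine measure_iUnion_null fun j => ?_
    -- Applied to `ε = ±1`: agreement up to sign would force `i = j`, and then `α` would act
    -- trivially, against the choice of a nontrivial transformation.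
    have key : ∀ ε : SL(2, ℤ), ε ∈ Gamma0 N → (∀ τ : ℍ, ε • τ = τ) →
        (α * γ i)⁻¹ ≠ (γ j)⁻¹ * ε := by
      intro ε hε hεt h
      have h1 : α * γ i = ε⁻¹ * γ j := by
        rw [← inv_inj, h, mul_inv_rev, inv_inv]
      have hij := hγ.eq_of_eq_mul hα (inv_mem hε) h1
      subst hij
      have h2 : α = ε⁻¹ := mul_right_cancel h1
      refine hne (Subtype.ext (Equiv.ext fun τ => ?_))
      show α • τ = τ
      rw [h2, inv_smul_eq_iff, hεt]
    refine volume_inter_translates ?_ ?_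
    · simpa using key 1 (one_mem _) (one_smul _)
    · have := key (-1) neg_one_mem_Gamma0 fun τ => by rw [SL_neg_smul, one_smul]
      simpa using this

instance : Countable (gamma0Transformations N) := by
  have : Function.Surjective fun α : Gamma0 N =>
      (⟨MulAction.toPermHom SL(2, ℤ) ℍ α, α, α.2, rfl⟩ : gamma0Transformations N) := by
    rintro ⟨_, α, hα, rfl⟩
    exact ⟨⟨α, hα⟩, rfl⟩
  have : Countable (Matrix (Fin 2) (Fin 2) ℤ) := inferInstanceAs (Countable (Fin 2 → Fin 2 → ℤ))
  have : Countable SL(2, ℤ) := Subtype.countable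
  exact Function.Surjective.countable ‹_›

instance : MeasurableConstSMul (gamma0Transformations N) ℍ where
  measurable_const_smul := by
    rintro ⟨_, α, hα, rfl⟩
    exact (measurePreserving_SL_smul α).measurable

instance : SMulInvariantMeasure (gamma0Transformations N) ℍ volume where
  measure_preimage_smul := by
    rintro ⟨_, α, hα, rfl⟩ s hs
    exact (measurePreserving_SL_smul α).measure_preimage hs.nullMeasurableSet

/-- The integral over a fundamental domain of `Γ₀(N)` is the sum over the right cosets of integrals
over the standard fundamental domain of `SL₂(ℤ)`. -/
lemma setIntegral_gamma0FundamentalDomain (hγ : IsRightCosetDecomposition N γ) {D : Set ℍ}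
    (hD : IsGamma0FundamentalDomain N D) {Φ : ℍ → ℂ}
    (hΦ : ∀ α ∈ Gamma0 N, ∀ τ : ℍ, Φ (α • τ) = Φ τ)
    (hint : ∀ j, IntegrableOn (fun τ => Φ (γ j • τ)) 𝒟) :
    IntegrableOn Φ D ∧ ∫ τ in D, Φ τ = ∑ j, ∫ τ in 𝒟, Φ (γ j • τ) := by
  have hD' := isGamma0FundamentalDomain_unionTranslates hγ
  have hinv : ∀ (g : gamma0Transformations N) (τ : ℍ), Φ (g • τ) = Φ τ := by
    rintro ⟨_, α, hα, rfl⟩ τ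
    exact hΦ α hα τ
  have hpre : ∀ j, (fun τ : ℍ => γ j • τ) ⁻¹' ((fun τ : ℍ => (γ j)⁻¹ • τ) ⁻¹' 𝒟) = 𝒟 := by
    intro j
    ext τ
    simp
  have hj : ∀ j, IntegrableOn Φ ((fun τ : ℍ => (γ j)⁻¹ • τ) ⁻¹' 𝒟) := by
    intro j
    rw [← (measurePreserving_SL_smul (γ j)).integrableOn_comp_preimage
      (measurableEmbedding_SL_smul (γ j)), hpre]
    exact hint j
  have hU : IntegrableOn Φ (unionTranslates γ) := integrableOn_finite_iUnion.mpr hj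
  -- As `-1 ∈ Γ₀(N)`, distinct cosets have representatives that differ even up to sign.
  have hd : Pairwise (Function.onFun (AEDisjoint volume)
      fun j => (fun τ : ℍ => (γ j)⁻¹ • τ) ⁻¹' 𝒟) := by
    intro i j hij
    refine volume_inter_translates (fun h => hij ?_) (fun h => hij ?_)
    · exact hγ.eq_of_eq_mul (one_mem _) (one_mem _) (by rw [inv_inj.mp h])
    · refine hγ.eq_of_eq_mul (one_mem _) neg_one_mem_Gamma0 ?_
      rw [← inv_inj, one_mul, h]
      simp
  refine ⟨(hD'.integrableOn_iff hD hinv).mp hU, ?_⟩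
  rw [hD.setIntegral_eq hD' hinv, unionTranslates,
    integral_iUnion_ae (fun j => (measurableSet_translate _).nullMeasurableSet) hd hU, tsum_fintype]
  refine Finset.sum_congr rfl fun j _ => ?_
  rw [← (measurePreserving_SL_smul (γ j)).setIntegral_preimage_emb
      (measurableEmbedding_SL_smul (γ j)), hpre]

end

/-! ### Growth of cusp forms at the cusps -/

/-- A holomorphic function on `ℍ` all of whose weight `k` translates under `SL₂(ℤ)` satisfy the
growth conditions of a cusp form. -/
structure IsCuspidal (k : ℕ) (h : ℍ → ℂ) : Prop where
  holo : MDiff h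
  decay : ∀ δ : SL(2, ℤ), ∃ C c : ℝ, 0 < c ∧
    ∀ τ : ℍ, τ.im ^ k * ‖(h ∣[(k : ℤ)] δ) τ‖ ≤ C * Real.exp (-c * τ.im)

lemma exists_pow_le_mul_exp (a : ℝ) (ha : 0 ≤ a) (n : ℕ) {c : ℝ} (hc : 0 < c) :
    ∃ K : ℝ, 0 ≤ K ∧ ∀ t : ℝ, 0 ≤ t → (a + t) ^ n ≤ K * Real.exp (c * t) := by
  refine ⟨n.factorial * c⁻¹ ^ n * Real.exp (c * a), by positivity, fun t ht => ?_⟩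
  have h := Real.pow_div_factorial_le_exp (c * (a + t)) (by positivity) n
  rw [div_le_iff₀ (by positivity), mul_pow, mul_add, Real.exp_add] at h
  have h2 : c⁻¹ ^ n * (c ^ n * (a + t) ^ n) = (a + t) ^ n := by
    rw [← mul_assoc, ← mul_pow, inv_mul_cancel₀ hc.ne', one_pow, one_mul]
  rw [← h2]
  calc c⁻¹ ^ n * (c ^ n * (a + t) ^ n) ≤
      c⁻¹ ^ n * (Real.exp (c * a) * Real.exp (c * t) * n.factorial) := by gcongr
    _ = _ := by ring

-- Two estimates are merged: exponential decay for large height, and the Hecke bound `|f| ≤ B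
-- y^{-k/2}` below a fixed height. The weight `y^k` makes the second bounded as `y → 0`; in the
-- first it is absorbed by halving the exponent.
open ConjAct Pointwise in
lemma isCuspidal_of_cuspFormClass {k : ℕ} {Γ : Subgroup (GL (Fin 2) ℝ)} [Γ.IsArithmetic]
    {F : Type*} [FunLike F ℍ ℂ] [CuspFormClass F Γ (k : ℤ)] (f : F) : IsCuspidal k f := by
  refine ⟨CuspFormClass.holo f, fun δ => ?_⟩
  have : ((toConjAct (δ : GL (Fin 2) ℝ)⁻¹) • Γ).IsArithmetic := by
    simpa [(show Rat.castHom ℝ = algebraMap ℚ ℝ by rfl), map_inv, Matrix.SpecialLinearGroup.map_mapGL]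
      using! Subgroup.IsArithmetic.conj Γ (Matrix.SpecialLinearGroup.mapGL ℚ δ)⁻¹
  obtain ⟨c, hc, hO⟩ := CuspFormClass.exp_decay_atImInfty' (CuspForm.translate f (δ : GL (Fin 2) ℝ))
  obtain ⟨B, hB⟩ := CuspFormClass.exists_bound (CuspForm.translate f (δ : GL (Fin 2) ℝ))
  change ((f : ℍ → ℂ) ∣[(k : ℤ)] δ) =O[atImInfty] _ at hO
  change ∀ τ, ‖((f : ℍ → ℂ) ∣[(k : ℤ)] δ) τ‖ ≤ _ at hB
  obtain ⟨A, hA⟩ := hO.bound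
  rw [atImInfty, eventually_comap, eventually_atTop] at hA
  obtain ⟨Y, hY⟩ := hA
  obtain ⟨K, hK, hpow⟩ := exists_pow_le_mul_exp 0 le_rfl k (half_pos hc)
  have hB0 : 0 ≤ B := by
    have := (norm_nonneg _).trans (hB UpperHalfPlane.I)
    simpa using this
  set Y' := max Y 1 with hY'
  have hY1 : 1 ≤ Y' := le_max_right _ _
  -- The exponential factor compensates `e^{-(c/2) y}`, which is at least `e^{-(c/2) Y'}` for `y ≤
  -- Y'`.
  set M := Y' ^ k * B * Real.exp (c / 2 * Y') with hM
  have hM0 : 0 ≤ M := by positivity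
  refine ⟨max (K * |A|) M, c / 2, half_pos hc, fun τ => ?_⟩
  have hτ := τ.im_pos
  rcases le_total Y' τ.im with h | h
  · have h1 := hY τ.im ((le_max_left _ _).trans h) τ rfl
    rw [Real.norm_of_nonneg (Real.exp_pos _).le] at h1
    have h2 := hpow τ.im hτ.le
    rw [zero_add] at h2
    calc τ.im ^ k * ‖((f : ℍ → ℂ) ∣[(k : ℤ)] δ) τ‖
        ≤ (K * Real.exp (c / 2 * τ.im)) * (|A| * Real.exp (-c * τ.im)) := by
          gcongr
          exact h1.trans (by gcongr; exact le_abs_self A)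
      _ = K * |A| * Real.exp (-(c / 2) * τ.im) := by
          rw [mul_mul_mul_comm, ← Real.exp_add]
          ring_nf
      _ ≤ _ := by gcongr; exact le_max_left _ _
  · have h1 : τ.im ^ k * ‖((f : ℍ → ℂ) ∣[(k : ℤ)] δ) τ‖ ≤ Y' ^ k * B := by
      have hpos : 0 < τ.im ^ ((k : ℝ) / 2) := Real.rpow_pos_of_pos hτ _
      have h2 := hB τ
      rw [Int.cast_natCast, le_div_iff₀ hpos] at h2
      have h3 : τ.im ^ k = τ.im ^ ((k : ℝ) / 2) * τ.im ^ ((k : ℝ) / 2) := by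
        rw [← Real.rpow_add hτ, add_halves, Real.rpow_natCast]
      have h4 : τ.im ^ ((k : ℝ) / 2) ≤ Y' ^ k := by
        calc τ.im ^ ((k : ℝ) / 2) ≤ Y' ^ ((k : ℝ) / 2) :=
              Real.rpow_le_rpow hτ.le h (by positivity)
          _ ≤ Y' ^ (k : ℝ) := Real.rpow_le_rpow_of_exponent_le hY1
              (half_le_self (Nat.cast_nonneg k))
          _ = Y' ^ k := Real.rpow_natCast _ _
      rw [h3, mul_assoc]
      refine mul_le_mul h4 ?_ (by positivity) (by positivity)
      rwa [mul_comm]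
    calc _ ≤ Y' ^ k * B := h1
      _ = M * Real.exp (-(c / 2) * Y') := by
          rw [hM, mul_assoc, ← Real.exp_add]
          simp
      _ ≤ _ := by
          refine mul_le_mul (le_max_right _ _) (Real.exp_le_exp.mpr ?_) (Real.exp_pos _).le
            (hM0.trans (le_max_right _ _))
          nlinarith

namespace IsCuspidal

variable {k : ℕ} {h : ℍ → ℂ}

lemma slash (hh : IsCuspidal k h) (δ : SL(2, ℤ)) : IsCuspidal k (h ∣[(k : ℤ)] δ) := by
  refine ⟨hh.holo.slash k (δ : GL (Fin 2) ℝ), fun ε => ?_⟩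
  rw [← SlashAction.slash_mul]
  exact hh.decay (δ * ε)

lemma _root_.HaberlandPetersson.slash_S_apply (h : ℍ → ℂ) (τ : ℍ) :
    (h ∣[(k : ℤ)] S) τ = h (S • τ) * (τ : ℂ) ^ (-(k : ℤ)) := by
  rw [ModularForm.SL_slash_apply, denom_S]

lemma _root_.HaberlandPetersson.slash_T_zpow_apply (h : ℍ → ℂ) (n : ℤ) (τ : ℍ) :
    (h ∣[(k : ℤ)] (T ^ n)) τ = h (T ^ n • τ) := by
  rw [ModularForm.SL_slash_apply, ModularGroup.denom_apply]
  simp [coe_T_zpow]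

/-- `S` carries the cusp `0` to `i∞`. The decay of `h ∣ S⁻¹` controls `(Im τ / |τ|²)^k` times its
value at `S τ`, while `h τ` carries the factor `|τ|^{-k}`; the ratio `(|τ| / Im τ)^k` is at most
`2^k` in the cone. -/
lemma bounded_cone_zero (hh : IsCuspidal k h) :
    ∃ C : ℝ, ∀ τ : ℍ, ‖(τ : ℂ)‖ ≤ 2 * τ.im → ‖h τ‖ ≤ C := by
  obtain ⟨C, c, hc, H⟩ := hh.decay S⁻¹
  refine ⟨2 ^ k * max C 0, fun τ hτ => ?_⟩
  have him := τ.im_pos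
  have hn : 0 < ‖(τ : ℂ)‖ := norm_pos_iff.mpr τ.ne_zero
  have e : h τ = (h ∣[(k : ℤ)] S⁻¹) (S • τ) * (τ : ℂ) ^ (-(k : ℤ)) := by
    rw [← slash_S_apply, ← SlashAction.slash_mul, inv_mul_cancel, SlashAction.slash_one]
  have H1 := H (S • τ)
  have hS : (S • τ).im = τ.im / ‖(τ : ℂ)‖ ^ 2 := by
    rw [im_S_smul, ← normSq_coe, Complex.normSq_eq_norm_sq]
  have H2 : (τ.im / ‖(τ : ℂ)‖ ^ 2) ^ k * ‖(h ∣[(k : ℤ)] S⁻¹) (S • τ)‖ ≤ max C 0 := by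
    rw [← hS]
    refine H1.trans ?_
    calc C * Real.exp (-c * (S • τ).im) ≤ max C 0 * Real.exp (-c * (S • τ).im) := by
          gcongr; exact le_max_left _ _
      _ ≤ max C 0 := by
          refine mul_le_of_le_one_right (le_max_right _ _) (Real.exp_le_one_iff.mpr ?_)
          nlinarith [(S • τ).im_pos]
  set X := ‖(h ∣[(k : ℤ)] S⁻¹) (S • τ)‖ with hX
  have hX0 : 0 ≤ X := norm_nonneg _
  rw [e, norm_mul, norm_zpow, ← hX, zpow_neg, zpow_natCast]
  calc X * (‖(τ : ℂ)‖ ^ k)⁻¹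
      = (‖(τ : ℂ)‖ / τ.im) ^ k * ((τ.im / ‖(τ : ℂ)‖ ^ 2) ^ k * X) := by
        rw [div_pow, div_pow]
        field_simp
        ring
    _ ≤ 2 ^ k * max C 0 := by
        gcongr
        rwa [div_le_iff₀ him]

lemma bounded_cone (hh : IsCuspidal k h) (p : ℤ) :
    ∃ C : ℝ, ∀ τ : ℍ, ‖(τ : ℂ) - p‖ ≤ 2 * τ.im → ‖h τ‖ ≤ C := by
  obtain ⟨C, H⟩ := (hh.slash (T ^ p)).bounded_cone_zero
  refine ⟨C, fun τ hτ => ?_⟩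
  have h1 := H (T ^ (-p) • τ)
  rw [slash_T_zpow_apply, smul_smul, ← zpow_add, add_neg_cancel, zpow_zero, one_smul,
    coe_T_zpow_smul_eq, im_T_zpow_smul] at h1
  refine h1 ?_
  simpa [sub_eq_add_neg] using hτ

/-- Exponential decay on the union of the cones `|τ - p| ≤ 2 Im τ`, `p = -1, 0, 1`. -/
lemma exp_decay_cones (hh : IsCuspidal k h) :
    ∃ C c : ℝ, 0 < c ∧ 0 ≤ C ∧ ∀ τ : ℍ, (‖(τ : ℂ)‖ ≤ 2 * τ.im ∨ ‖(τ : ℂ) - 1‖ ≤ 2 * τ.im ∨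
      ‖(τ : ℂ) + 1‖ ≤ 2 * τ.im) → ‖h τ‖ ≤ C * Real.exp (-c * τ.im) := by
  obtain ⟨C₀, h₀⟩ := hh.bounded_cone 0
  obtain ⟨C₁, h₁⟩ := hh.bounded_cone 1
  obtain ⟨C₂, h₂⟩ := hh.bounded_cone (-1)
  obtain ⟨C, c, hc, H⟩ := hh.decay 1
  rw [SlashAction.slash_one] at H
  set B := max (max C₀ (max C₁ C₂)) 0 with hB
  have hB0 : 0 ≤ B := le_max_right _ _
  refine ⟨max C (B * Real.exp c), c, hc, le_max_of_le_right (by positivity), fun τ hτ => ?_⟩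
  rcases le_total 1 τ.im with h1 | h1
  · calc ‖h τ‖ ≤ τ.im ^ k * ‖h τ‖ := le_mul_of_one_le_left (norm_nonneg _) (one_le_pow₀ h1)
      _ ≤ C * Real.exp (-c * τ.im) := H τ
      _ ≤ _ := by gcongr; exact le_max_left _ _
  · have hb : ‖h τ‖ ≤ B := by
      refine le_trans ?_ (le_max_left _ _)
      rcases hτ with h | h | h
      · exact (h₀ τ (by simpa using h)).trans (le_max_left _ _)
      · exact (h₁ τ (by simpa using h)).trans ((le_max_left _ _).trans (le_max_right _ _))
      · exact (h₂ τ (by simpa using h)).trans ((le_max_right _ _).trans (le_max_right _ _))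
    calc ‖h τ‖ ≤ B * 1 := by rwa [mul_one]
      _ ≤ B * (Real.exp c * Real.exp (-c * τ.im)) := by
          gcongr
          rw [← Real.exp_add]
          exact Real.one_le_exp (by nlinarith)
      _ ≤ _ := by
          rw [← mul_assoc]
          gcongr
          exact le_max_right _ _

lemma _root_.HaberlandPetersson.periodIntegrand_of_im_pos (n : ℕ) (h : ℍ → ℂ) {z : ℂ}
    (hz : 0 < z.im) : periodIntegrand n h z = z ^ n * h ⟨z, hz⟩ := by
  rw [periodIntegrand, ofComplex_apply_of_im_pos hz]

lemma differentiableOn_periodIntegrand (hh : IsCuspidal k h) (n : ℕ) :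
    DifferentiableOn ℂ (periodIntegrand n h) upperHalfPlaneSet :=
  (by fun_prop : DifferentiableOn ℂ (fun z : ℂ => z ^ n) upperHalfPlaneSet).mul
    (UpperHalfPlane.mdifferentiable_iff.mp hh.holo)

/-- Near a fixed `z` the height is at least `Im z / 2`, so the weight `y^k` in `IsCuspidal` can be
divided out. Half of the exponent pays for the polynomial factor. -/
lemma verticallyDecaying (hh : IsCuspidal k h) (n : ℕ) :
    VerticallyDecaying (periodIntegrand n h) := by
  refine ⟨hh.differentiableOn_periodIntegrand n, fun z hz => ?_⟩
  obtain ⟨C, c, hc, H⟩ := hh.decay 1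
  rw [SlashAction.slash_one] at H
  obtain ⟨K, hK, hpow⟩ := exists_pow_le_mul_exp (‖z‖ + z.im) (by positivity) n (half_pos hc)
  refine ⟨z.im / 2, K * (|C| / (z.im / 2) ^ k), c / 2, half_pos hz, half_pos hc,
    fun w hw t ht => ?_⟩
  have hwz : ‖w - z‖ < z.im / 2 := by simpa [dist_eq_norm] using hw
  have him : z.im / 2 + t ≤ (w + t * Complex.I).im := by
    have h1 := (abs_le.mp ((Complex.abs_im_le_norm (w - z)).trans hwz.le)).1
    rw [im_add_mul_I]
    simp only [Complex.sub_im] at h1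
    linarith
  have hpos : 0 < (w + t * Complex.I).im := by linarith
  rw [periodIntegrand_of_im_pos n h hpos, norm_mul, norm_pow]
  have h1 := H ⟨_, hpos⟩
  have hn : ‖w + t * Complex.I‖ ≤ (‖z‖ + z.im) + t := by
    calc ‖w + t * Complex.I‖ = ‖z + (w - z) + t * Complex.I‖ := by ring_nf
      _ ≤ ‖z‖ + ‖w - z‖ + ‖t * Complex.I‖ := norm_add₃_le
      _ ≤ _ := by
        have : ‖(t : ℂ) * Complex.I‖ = t := by simp [abs_of_nonneg ht]
        rw [this]
        linarith
  have h2 : ‖h ⟨_, hpos⟩‖ ≤ |C| / (z.im / 2) ^ k * Real.exp (-c * t) := by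
    rw [div_mul_eq_mul_div, le_div_iff₀ (by positivity), mul_comm]
    calc (z.im / 2) ^ k * ‖h ⟨_, hpos⟩‖ ≤ (w + t * Complex.I).im ^ k * ‖h ⟨_, hpos⟩‖ := by
          gcongr
          linarith
      _ ≤ C * Real.exp (-c * (w + t * Complex.I).im) := h1
      _ ≤ |C| * Real.exp (-c * t) := by
          refine mul_le_mul (le_abs_self C) (Real.exp_le_exp.mpr ?_) (Real.exp_pos _).le
            (abs_nonneg C)
          nlinarith
  calc ‖w + t * Complex.I‖ ^ n * ‖h ⟨_, hpos⟩‖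
      ≤ (K * Real.exp (c / 2 * t)) * (|C| / (z.im / 2) ^ k * Real.exp (-c * t)) := by
        gcongr
        exact (pow_le_pow_left₀ (norm_nonneg _) hn n).trans (hpow t ht)
    _ = _ := by
        rw [mul_mul_mul_comm, ← Real.exp_add]
        ring_nf

/-- The parameter `s` measures height and bounds `|z|` by `1 + s`. This form serves both `e^{iθ} +
is` and the imaginary axis, where `s = y`. -/
lemma exists_cone_bound (hh : IsCuspidal k h) (n : ℕ) :
    ∃ C c : ℝ, 0 < c ∧ 0 ≤ C ∧ ∀ z : ℂ, ∀ s : ℝ, 0 ≤ s → s ≤ z.im → 0 < z.im → ‖z‖ ≤ 1 + s →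
      (‖z‖ ≤ 2 * z.im ∨ ‖z - 1‖ ≤ 2 * z.im ∨ ‖z + 1‖ ≤ 2 * z.im) →
      ‖periodIntegrand n h z‖ ≤ C * Real.exp (-c * s) := by
  obtain ⟨C, c, hc, hC, H⟩ := hh.exp_decay_cones
  obtain ⟨K, hK, hpow⟩ := exists_pow_le_mul_exp 1 zero_le_one n (half_pos hc)
  refine ⟨K * C, c / 2, half_pos hc, by positivity, fun z s hs hsz hz hzs hcone => ?_⟩
  rw [periodIntegrand_of_im_pos n h hz, norm_mul, norm_pow]
  calc ‖z‖ ^ n * ‖h ⟨z, hz⟩‖ ≤ (K * Real.exp (c / 2 * s)) * (C * Real.exp (-c * s)) := by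
        gcongr
        · exact (pow_le_pow_left₀ (norm_nonneg _) hzs n).trans (hpow s hs)
        · refine (H ⟨z, hz⟩ hcone).trans ?_
          refine mul_le_mul_of_nonneg_left (Real.exp_le_exp.mpr ?_) hC
          show -c * z.im ≤ -c * s
          nlinarith
    _ = _ := by
        rw [mul_mul_mul_comm, ← Real.exp_add]
        ring_nf

/-- The triangle lies in the union of the cones at `1` and `-1`: for `cos θ ≥ 0` one has `(1 - cos
θ)² ≤ 1 - cos² θ = sin² θ`, and symmetrically for `cos θ ≤ 0`. -/
lemma decaysAboveCircle (hh : IsCuspidal k h) (n : ℕ) :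
    DecaysAboveCircle (periodIntegrand n h) := by
  obtain ⟨C, c, hc, -, H⟩ := hh.exists_cone_bound n
  refine ⟨C, c, hc, fun θ hθ s hs hpos => ?_⟩
  have hsin := Real.sin_nonneg_of_mem_Icc hθ
  have hsq := Real.sin_sq_add_cos_sq θ
  have him : (Complex.exp (θ * Complex.I) + s * Complex.I).im = Real.sin θ + s := by
    rw [im_add_mul_I, exp_mul_I_im]
  have hre : (Complex.exp (θ * Complex.I) + s * Complex.I).re = Real.cos θ := by
    simp [Complex.exp_ofReal_mul_I_re]
  refine H _ s hs (by rw [him]; linarith) (by rw [him]; exact hpos) ?_ ?_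
  · refine (norm_add_le _ _).trans ?_
    rw [Complex.norm_exp_ofReal_mul_I]
    simp [abs_of_nonneg hs]
  · right
    rw [him, ← sq_le_sq₀ (norm_nonneg _) (by positivity), ← sq_le_sq₀ (norm_nonneg _) (by positivity),
      ← Complex.normSq_eq_norm_sq, ← Complex.normSq_eq_norm_sq, Complex.normSq_apply,
      Complex.normSq_apply]
    simp only [Complex.add_re, Complex.add_im, Complex.sub_re, Complex.sub_im, Complex.one_re,
      Complex.one_im] at him hre ⊢
    simp only [him, hre]
    have hc1 := Real.cos_le_one θ
    have hc2 := Real.neg_one_le_cos θ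
    have hs2 : Real.sin θ ^ 2 ≤ (Real.sin θ + s) ^ 2 := by gcongr; linarith
    rcases le_total 0 (Real.cos θ) with h0 | h0
    · left; nlinarith
    · right; nlinarith

/-- Decay along the imaginary axis, up to the cusp `0`. -/
lemma exists_bound_imaginary_axis (hh : IsCuspidal k h) (n : ℕ) :
    ∃ C c : ℝ, 0 < c ∧ 0 ≤ C ∧ ∀ y : ℝ, 0 < y →
      ‖periodIntegrand n h (y * Complex.I)‖ ≤ C * Real.exp (-c * y) := by
  obtain ⟨C, c, hc, hC, H⟩ := hh.exists_cone_bound n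
  refine ⟨C, c, hc, hC, fun y hy => H _ y hy.le ?_ ?_ ?_ (Or.inl ?_)⟩
  · simp
  · simpa using hy
  · simp [abs_of_pos hy]
  · simp [abs_of_pos hy]
    linarith

end IsCuspidal

/-! ### Eichler integrals and their transformation under `T` and `S` -/

lemma sum_choose_mul_pow (m : ℕ) (z w : ℂ) :
    ∑ n ∈ Finset.range (m + 1), (-1 : ℂ) ^ n * (m.choose n : ℂ) * w ^ n * z ^ (m - n) =
      (z - w) ^ m := by
  rw [show z - w = -w + z by ring, add_pow]
  refine Finset.sum_congr rfl fun n _ => ?_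
  rw [neg_pow]
  ring

/-- The integral `∫_{i∞}^z h(ζ) (ζ - w)^m dζ`, expanded by the binomial theorem. -/
noncomputable def eichlerIntegral (m : ℕ) (h : ℍ → ℂ) (z w : ℂ) : ℂ :=
  ∑ n ∈ Finset.range (m + 1), (-1 : ℂ) ^ n * (m.choose n : ℂ) * w ^ n *
    verticalPrimitive (periodIntegrand (m - n) h) z

lemma verticalPrimitive_periodIntegrand_smul (n : ℕ) (c : ℂ) (h : ℍ → ℂ) (z : ℂ) :
    verticalPrimitive (periodIntegrand n (c • h)) z =
      c * verticalPrimitive (periodIntegrand n h) z := by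
  have : ∀ t : ℝ, periodIntegrand n (c • h) (z + t * Complex.I) =
      c * periodIntegrand n h (z + t * Complex.I) := fun t => by
    simp only [periodIntegrand, Pi.smul_apply, smul_eq_mul]
    ring
  simp only [verticalPrimitive, this, integral_const_mul]
  ring

lemma eichlerIntegral_smul (m : ℕ) (c : ℂ) (h : ℍ → ℂ) (z w : ℂ) :
    eichlerIntegral m (c • h) z w = c * eichlerIntegral m h z w := by
  simp only [eichlerIntegral, verticalPrimitive_periodIntegrand_smul, Finset.mul_sum]
  refine Finset.sum_congr rfl fun n _ => ?_
  ring

namespace IsCuspidal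

variable {k : ℕ} {h : ℍ → ℂ}

lemma eichlerIntegral_eq (hh : IsCuspidal k h) (m : ℕ) {z : ℂ} (hz : 0 < z.im) (w : ℂ) :
    eichlerIntegral m h z w = -Complex.I * ∫ t in Ioi (0 : ℝ),
      h (ofComplex (z + t * Complex.I)) * (z + t * Complex.I - w) ^ m := by
  have e : ∀ t : ℝ, h (ofComplex (z + t * Complex.I)) * (z + t * Complex.I - w) ^ m =
      ∑ n ∈ Finset.range (m + 1), (-1 : ℂ) ^ n * (m.choose n : ℂ) * w ^ n *
        periodIntegrand (m - n) h (z + t * Complex.I) := fun t => by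
    rw [← sum_choose_mul_pow, Finset.mul_sum]
    refine Finset.sum_congr rfl fun n _ => ?_
    rw [periodIntegrand]
    ring
  simp only [e]
  rw [integral_finsetSum _ fun n _ => ((hh.verticallyDecaying (m - n)).integrableOn hz).const_mul _,
    Finset.mul_sum, eichlerIntegral]
  refine Finset.sum_congr rfl fun n _ => ?_
  rw [integral_const_mul, verticalPrimitive]
  ring

lemma hasDerivAt_eichlerIntegral (hh : IsCuspidal k h) (m : ℕ) {z : ℂ} (hz : 0 < z.im) (w : ℂ) :
    HasDerivAt (fun z => eichlerIntegral m h z w) ((z - w) ^ m * h (ofComplex z)) z := by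
  have := HasDerivAt.fun_sum (u := Finset.range (m + 1)) fun n _ =>
    ((hh.verticallyDecaying (m - n)).hasDerivAt_verticalPrimitive hz).const_mul
      ((-1 : ℂ) ^ n * (m.choose n : ℂ) * w ^ n)
  refine this.congr_deriv ?_
  rw [← sum_choose_mul_pow, Finset.sum_mul]
  refine Finset.sum_congr rfl fun n _ => ?_
  rw [periodIntegrand]
  ring

/-- Translation fixes `i∞` and the kernel depends only on `ζ - w`, so there is no period correction.
-/
lemma eichlerIntegral_slash_T_zpow (hh : IsCuspidal k h) (m : ℕ) (p : ℤ) {z : ℂ} (hz : 0 < z.im)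
    (w : ℂ) : eichlerIntegral m (h ∣[(k : ℤ)] (T ^ p)) z w = eichlerIntegral m h (z + p) (w + p) := by
  rw [(hh.slash _).eichlerIntegral_eq m hz, hh.eichlerIntegral_eq m (by simpa using hz)]
  congr 1
  refine setIntegral_congr_fun measurableSet_Ioi fun t ht => ?_
  have h1 : 0 < (z + t * Complex.I).im := add_mul_I_mem hz (le_of_lt ht)
  have h2 : 0 < (z + p + t * Complex.I).im := by simpa using h1
  simp only [slash_T_zpow_apply, ofComplex_apply_of_im_pos h1, ofComplex_apply_of_im_pos h2]
  congr 1
  · congr 1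
    ext1
    rw [coe_T_zpow_smul_eq]
    ring
  · ring

/-- Dominated convergence: the exponential bound on the imaginary axis holds down to the cusp `0`.
The limit is, up to sign, the full period from `0` to `i∞`. -/
lemma tendsto_verticalPrimitive_zero (hh : IsCuspidal k h) (n : ℕ) :
    Tendsto (fun y : ℝ => verticalPrimitive (periodIntegrand n h) (y * Complex.I)) (𝓝[>] 0)
      (𝓝 (verticalPrimitive (periodIntegrand n h) 0)) := by
  obtain ⟨C, c, hc, hC, H⟩ := hh.exists_bound_imaginary_axis n
  refine Tendsto.const_mul _ ?_
  refine tendsto_integral_filter_of_dominated_convergence (fun t => C * Real.exp (-c * t)) ?_ ?_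
    (integrableOn_const_mul_exp C hc) ?_
  · filter_upwards [self_mem_nhdsWithin] with y hy
    refine (hh.differentiableOn_periodIntegrand n).continuousOn.aestronglyMeasurable_vertical ?_
    simpa using le_of_lt hy
  · filter_upwards [self_mem_nhdsWithin] with y hy
    filter_upwards [ae_restrict_mem measurableSet_Ioi] with t ht
    have hy' : 0 < y := hy
    have ht' : 0 < t := ht
    have := H (y + t) (by positivity)
    rw [Complex.ofReal_add, add_mul] at this
    refine this.trans ?_
    refine mul_le_mul_of_nonneg_left (Real.exp_le_exp.mpr ?_) hC
    nlinarith
  · filter_upwards [ae_restrict_mem measurableSet_Ioi] with t ht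
    have ht' : 0 < t := ht
    have hm : (0 : ℂ) + t * Complex.I ∈ upperHalfPlaneSet := by
      show 0 < ((0 : ℂ) + t * Complex.I).im
      simpa using ht'
    have hc := ((hh.differentiableOn_periodIntegrand n).continuousOn.continuousAt
      (isOpen_upperHalfPlaneSet.mem_nhds hm)).tendsto
    refine hc.comp ?_
    have : Continuous fun y : ℝ => (y : ℂ) * Complex.I + t * Complex.I := by fun_prop
    have h0 := (this.tendsto 0).mono_left (nhdsWithin_le_nhds (s := Ioi 0))
    simpa using h0

lemma tendsto_verticalPrimitive_atTop (hh : IsCuspidal k h) (n : ℕ) :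
    Tendsto (fun y : ℝ => verticalPrimitive (periodIntegrand n h) (y * Complex.I)) atTop (𝓝 0) := by
  obtain ⟨δ, C, c, hδ, hc, H⟩ := (hh.verticallyDecaying n).verticalPrimitive.decay Complex.I
    (by simp)
  refine squeeze_zero_norm' (a := fun y => C * Real.exp (-c * (y - 1))) ?_ ?_
  · filter_upwards [eventually_ge_atTop 1] with y hy
    have := H Complex.I (mem_ball_self hδ) (y - 1) (by linarith)
    have e : (y : ℂ) * Complex.I = Complex.I + ((y - 1 : ℝ) : ℂ) * Complex.I := by
      push_cast
      ring
    rwa [e]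
  · have h1 : Tendsto (fun y : ℝ => -c * (y - 1)) atTop atBot :=
      (tendsto_atTop_add_const_right _ (-1) tendsto_id).const_mul_atTop_of_neg (neg_lt_zero.mpr hc)
    simpa using (Real.tendsto_exp_atBot.comp h1).const_mul C

/-- The cocycle relation of the Eichler integral for `S`. -/
lemma eichlerIntegral_slash_S {m : ℕ} (hh : IsCuspidal (m + 2) h) {z w : ℂ} (hz : 0 < z.im)
    (hw : w ≠ 0) :
    eichlerIntegral m (h ∣[((m + 2 : ℕ) : ℤ)] S) z w - w ^ m * eichlerIntegral m h (-1 / z) (-1 / w) =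
      eichlerIntegral m (h ∣[((m + 2 : ℕ) : ℤ)] S) 0 w := by
  set D : ℂ → ℂ := fun z => eichlerIntegral m (h ∣[((m + 2 : ℕ) : ℤ)] S) z w -
    w ^ m * eichlerIntegral m h (-1 / z) (-1 / w) with hD
  have hS : ∀ z : ℂ, 0 < z.im → 0 < (-1 / z).im := by
    intro z hz
    have h0 : z ≠ 0 := fun h => by simp [h] at hz
    rw [neg_div, one_div, Complex.neg_im, Complex.inv_im, neg_div, neg_neg]
    exact div_pos hz (Complex.normSq_pos.mpr h0)
  -- Weight `m + 2` is what makes this work: under `z ↦ -1/z` the kernel contributes `(zw)^{-m}` and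
  -- the differential `z^{-2}`, which matches the automorphy factor after multiplication by `w^m`.
  have hder : ∀ z ∈ upperHalfPlaneSet, HasDerivAt D 0 z := by
    intro z hz
    have hz0 : z ≠ 0 := fun h => by
      rw [h] at hz
      exact absurd hz (by simp [upperHalfPlaneSet])
    have hz' : 0 < z.im := hz
    have h1 := (hh.slash S).hasDerivAt_eichlerIntegral m hz' w
    have h2 := hh.hasDerivAt_eichlerIntegral m (hS z hz) (-1 / w)
    have h3 : HasDerivAt (fun z : ℂ => -1 / z) (1 / z ^ 2) z := by
      have := (hasDerivAt_inv hz0).const_mul (-1 : ℂ)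
      convert! this using 1
      field_simp
    have h4 := (h2.comp z h3).const_mul (w ^ m)
    refine (h1.sub h4).congr_deriv ?_
    have e : (h ∣[((m + 2 : ℕ) : ℤ)] S) (ofComplex z) =
        h (ofComplex (-1 / z)) * (z ^ (m + 2))⁻¹ := by
      rw [ofComplex_apply_of_im_pos hz', ofComplex_apply_of_im_pos (hS z hz), slash_S_apply,
        zpow_neg, zpow_natCast]
      congr 2
      ext1
      rw [modular_S_smul]
      show (-z)⁻¹ = -1 / z
      rw [inv_neg, neg_div, one_div]
    rw [e]
    have e2 : (-1 / z - -1 / w) ^ m = (z - w) ^ m / (z ^ m * w ^ m) := by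
      rw [← mul_pow, ← div_pow]
      congr 1
      field_simp
      ring
    rw [e2]
    field_simp
    ring
  have hconst : ∀ y : ℝ, 0 < y → D z = D (y * Complex.I) := by
    intro y hy
    refine isOpen_upperHalfPlaneSet.is_const_of_deriv_eq_zero
      (convex_halfSpace_im_gt 0).isPreconnected
      (fun z hz => (hder z hz).differentiableAt.differentiableWithinAt)
      (fun z hz => (hder z hz).deriv) hz ?_
    show 0 < ((y : ℂ) * Complex.I).im
    simpa using hy
  -- The constant value of `D` is found by letting `z → 0` along the imaginary axis: `-1/z` tends to
  -- `i∞`, where the second Eichler integral vanishes.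
  have hlim : Tendsto (fun y : ℝ => D (y * Complex.I)) (𝓝[>] 0)
      (𝓝 (eichlerIntegral m (h ∣[((m + 2 : ℕ) : ℤ)] S) 0 w - w ^ m * 0)) := by
    refine Tendsto.sub ?_ (Tendsto.const_mul _ ?_)
    · exact tendsto_finsetSum _ fun n _ =>
        ((hh.slash S).tendsto_verticalPrimitive_zero (m - n)).const_mul _
    · have h1 : Tendsto (fun y : ℝ => eichlerIntegral m h (y * Complex.I) (-1 / w)) atTop (𝓝 0) := by
        have := tendsto_finsetSum (Finset.range (m + 1)) fun n _ =>
          (hh.tendsto_verticalPrimitive_atTop (m - n)).const_mul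
            ((-1 : ℂ) ^ n * (m.choose n : ℂ) * (-1 / w) ^ n)
        simpa [eichlerIntegral] using this
      have h2 := h1.comp (tendsto_inv_nhdsGT_zero (𝕜 := ℝ))
      refine h2.congr fun y => ?_
      simp only [Function.comp_apply]
      congr 1
      rw [Complex.ofReal_inv, ← div_div, div_eq_mul_inv (-1 / (y : ℂ)), Complex.inv_I]
      ring
  have hlim' : Tendsto (fun y : ℝ => D (y * Complex.I)) (𝓝[>] 0) (𝓝 (D z)) := by
    refine tendsto_const_nhds.congr' ?_
    filter_upwards [self_mem_nhdsWithin] with y hy using hconst y hy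
  have := tendsto_nhds_unique hlim' hlim
  rwa [mul_zero, sub_zero] at this

end IsCuspidal

/-! ### The pairing of two cusp forms and Stokes' theorem for it -/

lemma integrableOn_ray_verticalPrimitive {u v : ℂ → ℂ} (hu : VerticallyDecaying u)
    (hv : VerticallyDecaying v) (hu' : DecaysAboveCircle u) (hv' : DecaysAboveCircle v)
    {θ : ℝ} (hθ : θ ∈ Icc 0 Real.pi) :
    IntegrableOn (fun s : ℝ => conj (v (Complex.exp (θ * Complex.I) + s * Complex.I)) *
      verticalPrimitive u (Complex.exp (θ * Complex.I) + s * Complex.I)) (Ioi 0) := by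
  obtain ⟨C, c, hc, h⟩ := hu'.norm_conj_mul_le hv'
  have h0 := Real.sin_nonneg_of_mem_Icc hθ
  refine (integrableOn_const_mul_exp C hc).mono'
    ((continuousOn_conj_mul_verticalPrimitive hu hv).aestronglyMeasurable_vertical
      (by rwa [exp_mul_I_im])) ?_
  filter_upwards [ae_restrict_mem measurableSet_Ioi] with s hs
  exact (h θ hθ s (le_of_lt hs) (add_pos_of_nonneg_of_pos h0 hs)).1

/-- The function `conj (v z) * ∫_{i∞}^z u(ζ) (ζ - conj z)^m dζ`. -/
noncomputable def eichlerPairing (m : ℕ) (u v : ℍ → ℂ) (z : ℂ) : ℂ :=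
  conj (v (ofComplex z)) * eichlerIntegral m u z (conj z)

lemma eichlerPairing_smul_smul (m : ℕ) (c d : ℂ) (u v : ℍ → ℂ) (z : ℂ) :
    eichlerPairing m (c • u) (d • v) z = c * conj d * eichlerPairing m u v z := by
  simp only [eichlerPairing, eichlerIntegral_smul, Pi.smul_apply, smul_eq_mul, map_mul]
  ring

/-- The binomial expansion separates the holomorphic from the antiholomorphic dependence on `z`, so
Stokes' theorem for products `conj v * verticalPrimitive u` applies term by term. -/
lemma eichlerPairing_eq_sum (m : ℕ) (u v : ℍ → ℂ) (z : ℂ) :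
    eichlerPairing m u v z = ∑ n ∈ Finset.range (m + 1), (-1 : ℂ) ^ n * (m.choose n : ℂ) *
      (conj (periodIntegrand n v z) * verticalPrimitive (periodIntegrand (m - n) u) z) := by
  rw [eichlerPairing, eichlerIntegral, Finset.mul_sum]
  refine Finset.sum_congr rfl fun n _ => ?_
  rw [periodIntegrand, map_mul, map_pow]
  ring

/-- The Petersson density `u(τ) conj(v(τ)) y^k`. -/
noncomputable def peterssonDensity (k : ℕ) (u v : ℍ → ℂ) (τ : ℍ) : ℂ :=
  u τ * conj (v τ) * ((τ.im ^ (k : ℤ) : ℝ) : ℂ)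

section

variable {m : ℕ} {u v : ℍ → ℂ}

lemma integrableOn_eichlerPairing (hu : IsCuspidal (m + 2) u) (hv : IsCuspidal (m + 2) v)
    {θ : ℝ} (hθ : θ ∈ Icc 0 Real.pi) :
    IntegrableOn (fun s : ℝ => eichlerPairing m u v (Complex.exp (θ * Complex.I) + s * Complex.I))
      (Ioi 0) := by
  simp only [eichlerPairing_eq_sum]
  exact integrable_finsetSum _ fun n _ => (integrableOn_ray_verticalPrimitive
    (hu.verticallyDecaying _) (hv.verticallyDecaying _) (hu.decaysAboveCircle _)
    (hv.decaysAboveCircle _) hθ).const_mul _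

lemma coe_image_subset (A : Set ℍ) : UpperHalfPlane.coe '' A ⊆ upperHalfPlaneSet := by
  rintro _ ⟨τ, -, rfl⟩
  exact τ.im_pos

/-- The sum is `(z - z̄)^m u v̄ = (2iy)^m u v̄`. Writing `y^m` as `y^{-2} y^{m+2}` exhibits the
hyperbolic area element. -/
lemma sum_conj_periodIntegrand_mul {z : ℂ} (hz : 0 < z.im) :
    ∑ n ∈ Finset.range (m + 1), (-1 : ℂ) ^ n * (m.choose n : ℂ) *
        (conj (periodIntegrand n v z) * periodIntegrand (m - n) u z) =
      (2 * Complex.I) ^ m * ((1 / z.im ^ 2 : ℝ) •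
        (u (ofComplex z) * conj (v (ofComplex z)) * ((z.im ^ ((m + 2 : ℕ) : ℤ) : ℝ) : ℂ))) := by
  have h1 : z - conj z = 2 * Complex.I * z.im := by
    rw [Complex.sub_conj]
    push_cast
    ring
  have h2 : (z.im : ℂ) ≠ 0 := by exact_mod_cast hz.ne'
  calc _ = (∑ n ∈ Finset.range (m + 1), (-1 : ℂ) ^ n * (m.choose n : ℂ) * conj z ^ n *
        z ^ (m - n)) * (u (ofComplex z) * conj (v (ofComplex z))) := by
        rw [Finset.sum_mul]
        refine Finset.sum_congr rfl fun n _ => ?_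
        simp only [periodIntegrand, map_mul, map_pow]
        ring
    _ = _ := by
        rw [sum_choose_mul_pow, h1, mul_pow, Complex.real_smul, zpow_natCast]
        push_cast
        field_simp
        ring

/-- Stokes' theorem on the theta domain for a pair of cusp forms. -/
lemma eichlerPairing_stokes (hu : IsCuspidal (m + 2) u) (hv : IsCuspidal (m + 2) v) :
    IntegrableOn (peterssonDensity (m + 2) u v) thetaDomain ∧
    IntervalIntegrable (fun θ : ℝ => Complex.exp (-(θ * Complex.I)) *
      eichlerPairing m u v (Complex.exp (θ * Complex.I))) volume 0 Real.pi ∧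
    (∫ s in Ioi (0 : ℝ), eichlerPairing m u v (-1 + s * Complex.I)) -
      (∫ s in Ioi (0 : ℝ), eichlerPairing m u v (1 + s * Complex.I)) =
    -(∫ θ in (0 : ℝ)..Real.pi, Complex.exp (-(θ * Complex.I)) *
      eichlerPairing m u v (Complex.exp (θ * Complex.I))) -
      2 * ((2 * Complex.I) ^ m * ∫ τ in thetaDomain, peterssonDensity (m + 2) u v τ) := by
  set a : ℕ → ℂ := fun n => (-1 : ℂ) ^ n * (m.choose n : ℂ) with ha
  have hUd := fun n => hu.verticallyDecaying (m - n)
  have hVd := fun n => hv.verticallyDecaying n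
  have hUc := fun n => hu.decaysAboveCircle (m - n)
  have hVc := fun n => hv.decaysAboveCircle n
  have stokes := fun n => integral_ray_pi_sub_integral_ray_zero (hUd n) (hVd n) (hUc n) (hVc n)
  have dom : ∀ n, IntegrableOn (fun z => conj (periodIntegrand n v z) * periodIntegrand (m - n) u z)
      (UpperHalfPlane.coe '' thetaDomain) ∧
      ∫ z in UpperHalfPlane.coe '' thetaDomain,
        conj (periodIntegrand n v z) * periodIntegrand (m - n) u z =
        ∫ θ in (0 : ℝ)..Real.pi, Real.sin θ * ∫ s in Ioi (0 : ℝ),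
          conj (periodIntegrand n v (Complex.exp (θ * Complex.I) + s * Complex.I)) *
            periodIntegrand (m - n) u (Complex.exp (θ * Complex.I) + s * Complex.I) := by
    intro n
    obtain ⟨C, c, hc, h⟩ := (hUc n).norm_conj_mul_le (hVc n)
    exact integral_coe_image_thetaDomain
      ((Complex.continuous_conj.comp_continuousOn (hVd n).differentiableOn.continuousOn).mul
        (hUd n).differentiableOn.continuousOn) hc fun θ hθ s hs hp => (h θ hθ s hs hp).2
  have hmeas : MeasurableSet (UpperHalfPlane.coe '' thetaDomain) :=
    measurableEmbedding_coe.measurableSet_image.mpr isOpen_thetaDomain.measurableSet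
  set F : ℂ → ℂ := fun z => u (ofComplex z) * conj (v (ofComplex z)) *
    ((z.im ^ ((m + 2 : ℕ) : ℤ) : ℝ) : ℂ) with hF
  have hFτ : ∀ τ : ℍ, F τ = peterssonDensity (m + 2) u v τ := fun τ => by
    simp only [hF, peterssonDensity, ofComplex_apply, coe_im]
  have h2I : (2 * Complex.I) ^ m ≠ 0 := pow_ne_zero _ (by simp)
  have intSum : IntegrableOn (fun z => ∑ n ∈ Finset.range (m + 1), a n *
      (conj (periodIntegrand n v z) * periodIntegrand (m - n) u z))
      (UpperHalfPlane.coe '' thetaDomain) :=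
    integrable_finsetSum _ fun n _ => (dom n).1.const_mul _
  have hcongr : EqOn (fun z => ∑ n ∈ Finset.range (m + 1), a n *
      (conj (periodIntegrand n v z) * periodIntegrand (m - n) u z))
      (fun z => (2 * Complex.I) ^ m * ((1 / z.im ^ 2 : ℝ) • F z))
      (UpperHalfPlane.coe '' thetaDomain) := fun z hz =>
    sum_conj_periodIntegrand_mul (coe_image_subset _ hz)
  have hint : IntegrableOn (peterssonDensity (m + 2) u v) thetaDomain := by
    have h1 := (integrableOn_congr_fun hcongr hmeas).mp intSum
    have h2 := h1.const_mul ((2 * Complex.I) ^ m)⁻¹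
    simp only [← mul_assoc, inv_mul_cancel₀ h2I, one_mul] at h2
    have h3 := (integrableOn_upperHalfPlane_iff isOpen_thetaDomain.measurableSet F).mpr h2
    simpa only [hFτ] using h3
  have hI : (2 * Complex.I) ^ m * ∫ τ in thetaDomain, peterssonDensity (m + 2) u v τ =
      ∑ n ∈ Finset.range (m + 1), a n * ∫ θ in (0 : ℝ)..Real.pi, Real.sin θ * ∫ s in Ioi (0 : ℝ),
          conj (periodIntegrand n v (Complex.exp (θ * Complex.I) + s * Complex.I)) *
            periodIntegrand (m - n) u (Complex.exp (θ * Complex.I) + s * Complex.I) := by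
    simp only [← hFτ]
    rw [setIntegral_upperHalfPlane isOpen_thetaDomain.measurableSet F, ← integral_const_mul,
      ← setIntegral_congr_fun hmeas hcongr, integral_finsetSum _ fun n _ => (dom n).1.const_mul _]
    refine Finset.sum_congr rfl fun n _ => ?_
    rw [integral_const_mul, (dom n).2]
  have hray : ∀ θ ∈ Icc (0 : ℝ) Real.pi, ∫ s in Ioi (0 : ℝ),
      eichlerPairing m u v (Complex.exp (θ * Complex.I) + s * Complex.I) =
      ∑ n ∈ Finset.range (m + 1), a n * ∫ s in Ioi (0 : ℝ),
        conj (periodIntegrand n v (Complex.exp (θ * Complex.I) + s * Complex.I)) *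
          verticalPrimitive (periodIntegrand (m - n) u)
            (Complex.exp (θ * Complex.I) + s * Complex.I) := by
    intro θ hθ
    simp only [eichlerPairing_eq_sum]
    rw [integral_finsetSum _ fun n _ => (integrableOn_ray_verticalPrimitive (hUd n) (hVd n) (hUc n)
      (hVc n) hθ).const_mul _]
    simp only [integral_const_mul, ha]
  have hray0 := hray 0 ⟨le_rfl, Real.pi_pos.le⟩
  have hrayπ := hray Real.pi ⟨Real.pi_pos.le, le_rfl⟩
  simp only [Complex.ofReal_zero, zero_mul, Complex.exp_zero, Complex.exp_pi_mul_I] at hray0 hrayπ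
  have harc : (fun θ : ℝ => Complex.exp (-(θ * Complex.I)) *
      eichlerPairing m u v (Complex.exp (θ * Complex.I))) = fun θ : ℝ =>
      ∑ n ∈ Finset.range (m + 1), a n * (Complex.exp (-(θ * Complex.I)) *
        (conj (periodIntegrand n v (Complex.exp (θ * Complex.I))) *
          verticalPrimitive (periodIntegrand (m - n) u) (Complex.exp (θ * Complex.I)))) := by
    funext θ
    rw [eichlerPairing_eq_sum, Finset.mul_sum]
    refine Finset.sum_congr rfl fun n _ => ?_
    ring
  refine ⟨hint, ?_, ?_⟩
  · rw [harc]
    have := IntervalIntegrable.sum (Finset.range (m + 1)) fun n _ => (stokes n).1.const_mul (a n)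
    rwa [Finset.sum_fn] at this
  · rw [hray0, hrayπ, harc, intervalIntegral.integral_finsetSum fun n _ =>
      (stokes n).1.const_mul (a n), hI, ← Finset.sum_sub_distrib, Finset.mul_sum,
      ← Finset.sum_neg_distrib, ← Finset.sum_sub_distrib]
    refine Finset.sum_congr rfl fun n _ => ?_
    have h1 := (stokes n).2.2
    simp only [mul_assoc (2 : ℂ)] at h1
    rw [intervalIntegral.integral_const_mul] at h1
    rw [← mul_sub, h1, intervalIntegral.integral_const_mul]
    ring

end

/-! ### The two period integrals -/

lemma periodIntegral_zero_infty (n : ℕ) (h : ℍ → ℂ) :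
    periodIntegral n ((0 : ℂ) : OnePoint ℂ) ∞ h =
      -verticalPrimitive (periodIntegrand n h) 0 := by
  show ∫ y in Ioi (0 : ℂ).im, lineIntegrand n h (0 : ℂ).re y = _
  simp only [lineIntegrand, Complex.zero_im, Complex.zero_re, Complex.ofReal_zero,
    verticalPrimitive, integral_mul_const]
  ring

lemma arcCenter_neg_one_one : arcCenter (-1) 1 = 0 := by
  simp [arcCenter]

lemma arcRadius_neg_one_one : arcRadius (-1) 1 = 1 := by
  simp [arcRadius, arcCenter_neg_one_one]

lemma arcIntegrand_zero_one (n : ℕ) (h : ℍ → ℂ) (θ : ℝ) :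
    arcIntegrand n h 0 1 θ = periodIntegrand n h (Complex.exp (θ * Complex.I)) *
      (Complex.I * Complex.exp (θ * Complex.I)) := by
  simp [arcIntegrand]

/-- The geodesic from `-1` to `1` runs through the arguments from `π` down to `0`, whence the sign.
-/
lemma periodIntegral_neg_one_one (n : ℕ) (h : ℍ → ℂ) :
    periodIntegral n ((-1 : ℂ) : OnePoint ℂ) ((1 : ℂ) : OnePoint ℂ) h =
      -∫ θ in (0 : ℝ)..Real.pi, periodIntegrand n h (Complex.exp (θ * Complex.I)) *
        (Complex.I * Complex.exp (θ * Complex.I)) := by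
  show (if (-1 : ℂ).re = (1 : ℂ).re then _ else _) = _
  rw [if_neg (by norm_num), arcCenter_neg_one_one, arcRadius_neg_one_one,
    ← intervalIntegral.integral_symm]
  simp [arcIntegrand_zero_one]

section

variable {k : ℕ} {h : ℍ → ℂ}

lemma IsCuspidal.periodIntegrable_zero_infty (hh : IsCuspidal k h) (n : ℕ) :
    PeriodIntegrable n ((0 : ℂ) : OnePoint ℂ) ∞ h := by
  show IntegrableOn (lineIntegrand n h (0 : ℂ).re) (Ioi (0 : ℂ).im)
  obtain ⟨C, c, hc, -, H⟩ := hh.exists_bound_imaginary_axis n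
  have := integrableOn_vertical_of_le (z := 0)
    (hh.differentiableOn_periodIntegrand n).continuousOn le_rfl hc
    (by simpa using H)
  have e : lineIntegrand n h 0 = fun y : ℝ => periodIntegrand n h (y * Complex.I) * Complex.I := by
    funext y
    simp [lineIntegrand]
  rw [Complex.zero_re, Complex.zero_im, e]
  simpa [IntegrableOn] using Integrable.mul_const this Complex.I

lemma IsCuspidal.intervalIntegrable_arc (hh : IsCuspidal k h) (n : ℕ) :
    IntervalIntegrable (fun θ : ℝ => periodIntegrand n h (Complex.exp (θ * Complex.I)) *
      (Complex.I * Complex.exp (θ * Complex.I))) volume 0 Real.pi := by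
  obtain ⟨C, c, hc, H⟩ := hh.decaysAboveCircle n
  refine intervalIntegrable_of_bounded (C := C) Real.pi_pos.le ?_ fun θ hθ => ?_
  · refine ContinuousOn.aestronglyMeasurable ?_ measurableSet_Ioo
    refine ContinuousOn.mul ?_ (by fun_prop)
    refine (hh.differentiableOn_periodIntegrand n).continuousOn.comp
      (f := fun θ : ℝ => Complex.exp (θ * Complex.I)) (by fun_prop) fun θ hθ => ?_
    show 0 < (Complex.exp (θ * Complex.I)).im
    rw [exp_mul_I_im]
    exact Real.sin_pos_of_mem_Ioo hθ
  · rw [norm_mul, norm_I_mul_exp_mul_I, mul_one]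
    simpa using H θ (Ioo_subset_Icc_self hθ) 0 le_rfl (by simpa using Real.sin_pos_of_mem_Ioo hθ)

lemma IsCuspidal.periodIntegrable_neg_one_one (hh : IsCuspidal k h) (n : ℕ) :
    PeriodIntegrable n ((-1 : ℂ) : OnePoint ℂ) ((1 : ℂ) : OnePoint ℂ) h := by
  show (if (-1 : ℂ).re = (1 : ℂ).re then _ else _)
  rw [if_neg (by norm_num), arcCenter_neg_one_one, arcRadius_neg_one_one]
  have := (hh.intervalIntegrable_arc n).symm
  simpa [← arcIntegrand_zero_one] using this

end

/-! ### Haberland's formula on the triangle -/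

/-- `∑ⱼ B(uⱼ, vⱼ)` is unchanged when all `uⱼ`, `vⱼ` are translated by an element of `SL₂(ℤ)`,
for each `B` homogeneous in the first and conjugate homogeneous in the second variable. -/
def SlashInvariantSum (k : ℕ) {r : ℕ} (u v : Fin r → ℍ → ℂ) : Prop :=
  ∀ δ : SL(2, ℤ), ∀ B : (ℍ → ℂ) → (ℍ → ℂ) → ℂ,
    (∀ (c d : ℂ) (p q : ℍ → ℂ), B (c • p) (d • q) = c * conj d * B p q) →
    ∑ j, B (u j ∣[(k : ℤ)] δ) (v j ∣[(k : ℤ)] δ) = ∑ j, B (u j) (v j)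

section

variable {m r : ℕ} {u v : Fin r → ℍ → ℂ}

lemma eichlerPairing_slash_T_sq {p q : ℍ → ℂ} (hp : IsCuspidal (m + 2) p) {z : ℂ}
    (hz : 0 < z.im) :
    eichlerPairing m (p ∣[((m + 2 : ℕ) : ℤ)] (T ^ (2 : ℤ))) (q ∣[((m + 2 : ℕ) : ℤ)] (T ^ (2 : ℤ))) z =
      eichlerPairing m p q (z + 2) := by
  have hz2 : 0 < (z + 2).im := by simpa using hz
  rw [eichlerPairing, eichlerPairing, hp.eichlerIntegral_slash_T_zpow m 2 hz,
    ofComplex_apply_of_im_pos hz, ofComplex_apply_of_im_pos hz2, slash_T_zpow_apply]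
  congr 3
  · ext1
    rw [coe_T_zpow_smul_eq]
    simp
  · simpa using (map_ofNat (starRingEnd ℂ) 2).symm

/-- The cocycle relation at `w = z̄` contributes `z̄^{-m}` and the conjugate automorphy factor of
`q` contributes `z̄^{m+2}`, leaving `z̄²`. This cancels the Jacobian of `dz̄`. -/
lemma eichlerPairing_S {p q : ℍ → ℂ} (hp : IsCuspidal (m + 2) p) {z : ℂ} (hz : 0 < z.im) :
    eichlerPairing m p q (-1 / z) = conj z ^ 2 *
      (eichlerPairing m (p ∣[((m + 2 : ℕ) : ℤ)] S) (q ∣[((m + 2 : ℕ) : ℤ)] S) z -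
        conj ((q ∣[((m + 2 : ℕ) : ℤ)] S) (ofComplex z)) *
          eichlerIntegral m (p ∣[((m + 2 : ℕ) : ℤ)] S) 0 (conj z)) := by
  have hz0 : z ≠ 0 := fun h => by simp [h] at hz
  have hw0 : conj z ≠ 0 := (map_ne_zero _).mpr hz0
  have hS : 0 < (-1 / z).im := by
    rw [neg_div, one_div, Complex.neg_im, Complex.inv_im, neg_div, neg_neg]
    exact div_pos hz (Complex.normSq_pos.mpr hz0)
  have e : (q ∣[((m + 2 : ℕ) : ℤ)] S) (ofComplex z) =
      q (ofComplex (-1 / z)) * (z ^ (m + 2))⁻¹ := by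
    rw [ofComplex_apply_of_im_pos hz, ofComplex_apply_of_im_pos hS, slash_S_apply,
      zpow_neg, zpow_natCast]
    congr 2
    ext1
    rw [modular_S_smul]
    show (-z)⁻¹ = -1 / z
    rw [inv_neg, neg_div, one_div]
  have hcoc := hp.eichlerIntegral_slash_S hz hw0
  have hc : conj (-1 / z) = -1 / conj z := by simp
  rw [eichlerPairing, eichlerPairing, ← mul_sub, ← hcoc, e, hc]
  simp only [map_mul, map_inv₀, map_pow]
  field_simp
  ring

/-- Haberland's formula, in terms of the integral over the theta domain. -/
lemma haberland_thetaDomain (hu : ∀ j, IsCuspidal (m + 2) (u j))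
    (hv : ∀ j, IsCuspidal (m + 2) (v j)) (huv : SlashInvariantSum (m + 2) u v) :
    2 * (2 * Complex.I) ^ (m + 1) *
        ∑ j, ∫ τ in thetaDomain, peterssonDensity (m + 2) (u j) (v j) τ =
      ∑ j, ∑ n ∈ Finset.range (m + 1), (-1 : ℂ) ^ n * (m.choose n : ℂ) *
        periodIntegral (m - n) ((0 : ℂ) : OnePoint ℂ) ∞ (u j) *
          conj (periodIntegral n ((-1 : ℂ) : OnePoint ℂ) ((1 : ℂ) : OnePoint ℂ) (v j)) := by
  have stokes := fun j => eichlerPairing_stokes (hu j) (hv j)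
  set J : ℂ := ∑ j, ∫ θ in (0 : ℝ)..Real.pi, Complex.exp (-(θ * Complex.I)) *
      eichlerPairing m (u j) (v j) (Complex.exp (θ * Complex.I)) with hJ
  set K : ℂ := ∑ j, ∑ n ∈ Finset.range (m + 1), (-1 : ℂ) ^ n * (m.choose n : ℂ) *
        periodIntegral (m - n) ((0 : ℂ) : OnePoint ℂ) ∞ (u j) *
          conj (periodIntegral n ((-1 : ℂ) : OnePoint ℂ) ((1 : ℂ) : OnePoint ℂ) (v j)) with hK
  have sides : ∑ j, ∫ s in Ioi (0 : ℝ), eichlerPairing m (u j) (v j) (-1 + s * Complex.I) =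
      ∑ j, ∫ s in Ioi (0 : ℝ), eichlerPairing m (u j) (v j) (1 + s * Complex.I) := by
    have i0 := fun j => integrableOn_eichlerPairing (hu j) (hv j) (θ := 0)
      ⟨le_rfl, Real.pi_pos.le⟩
    have iπ := fun j => integrableOn_eichlerPairing (hu j) (hv j) (θ := Real.pi)
      ⟨Real.pi_pos.le, le_rfl⟩
    simp only [Complex.ofReal_zero, zero_mul, Complex.exp_zero, Complex.exp_pi_mul_I] at i0 iπ
    rw [← integral_finsetSum _ fun j _ => i0 j, ← integral_finsetSum _ fun j _ => iπ j]
    refine setIntegral_congr_fun measurableSet_Ioi fun s hs => ?_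
    have hz : 0 < (-1 + s * Complex.I : ℂ).im := by simpa using hs
    -- `T²` maps the side `Re = -1` to the side `Re = 1`; only the sum over `j` is unchanged by it.
    rw [← huv (T ^ (2 : ℤ)) (fun p q => eichlerPairing m p q (-1 + s * Complex.I))
      fun c d p q => eichlerPairing_smul_smul m c d p q _]
    refine Finset.sum_congr rfl fun j _ => ?_
    rw [eichlerPairing_slash_T_sq (hu j) hz]
    congr 1
    ring
  have hstokes : J = -(2 * (2 * Complex.I) ^ m) *
      ∑ j, ∫ τ in thetaDomain, peterssonDensity (m + 2) (u j) (v j) τ := by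
    have h1 := Finset.sum_congr rfl fun j (_ : j ∈ (Finset.univ : Finset (Fin r))) =>
      (stokes j).2.2
    rw [Finset.sum_sub_distrib, sides, sub_self, Finset.sum_sub_distrib, Finset.sum_neg_distrib,
      ← hJ, ← Finset.mul_sum, ← Finset.mul_sum] at h1
    linear_combination h1
  -- On the unit circle `S` is the reflection `θ ↦ π - θ`. The weight `e^{-iθ} = z⁻¹` becomes `-z`,
  -- and `-z · z̄² = -z⁻¹`, so the arc integrand changes sign up to the period term.
  have hpt : ∀ θ ∈ Ioo (0 : ℝ) Real.pi,
      ∑ j, Complex.exp (-(((Real.pi - θ : ℝ) : ℂ) * Complex.I)) *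
        eichlerPairing m (u j) (v j) (Complex.exp (((Real.pi - θ : ℝ) : ℂ) * Complex.I)) =
      -(∑ j, Complex.exp (-(θ * Complex.I)) *
        eichlerPairing m (u j) (v j) (Complex.exp (θ * Complex.I))) +
      ∑ j, ∑ n ∈ Finset.range (m + 1), (-1 : ℂ) ^ n * (m.choose n : ℂ) *
        periodIntegral (m - n) ((0 : ℂ) : OnePoint ℂ) ∞ (u j) * (-Complex.I) *
        conj (periodIntegrand n (v j) (Complex.exp (θ * Complex.I)) *
          (Complex.I * Complex.exp (θ * Complex.I))) := by
    intro θ hθ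
    set z : ℂ := Complex.exp (θ * Complex.I) with hz
    have hzim : 0 < z.im := by rw [hz, exp_mul_I_im]; exact Real.sin_pos_of_mem_Ioo hθ
    have hz0 : z ≠ 0 := Complex.exp_ne_zero _
    have hez : Complex.exp (-(θ * Complex.I)) = z⁻¹ := Complex.exp_neg _
    have hcz : conj z = z⁻¹ := by
      rw [← hez, hz, ← Complex.exp_conj]; simp
    have e1 : Complex.exp (((Real.pi - θ : ℝ) : ℂ) * Complex.I) = -1 / z := by
      push_cast
      rw [sub_mul, Complex.exp_sub, Complex.exp_pi_mul_I]
    have e2 : Complex.exp (-(((Real.pi - θ : ℝ) : ℂ) * Complex.I)) = -z := by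
      rw [Complex.exp_neg, e1, inv_div, div_neg, div_one]
    have hS := huv S (fun p q => eichlerPairing m p q z - conj (q (ofComplex z)) *
      eichlerIntegral m p 0 (conj z)) fun c d p q => by
        rw [eichlerPairing_smul_smul, eichlerIntegral_smul]
        simp only [Pi.smul_apply, smul_eq_mul, map_mul]
        ring
    rw [e1, e2, ← Finset.mul_sum, hez, ← Finset.mul_sum]
    rw [Finset.sum_congr rfl fun j _ => eichlerPairing_S (q := v j) (hu j) hzim, ← Finset.mul_sum, hS,
      Finset.sum_sub_distrib, hcz]
    have e3 : ∀ j, ∑ n ∈ Finset.range (m + 1), (-1 : ℂ) ^ n * (m.choose n : ℂ) *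
        periodIntegral (m - n) ((0 : ℂ) : OnePoint ℂ) ∞ (u j) * (-Complex.I) *
        conj (periodIntegrand n (v j) z * (Complex.I * z)) =
        z⁻¹ * (conj (v j (ofComplex z)) * eichlerIntegral m (u j) 0 z⁻¹) := by
      intro j
      rw [eichlerIntegral, Finset.mul_sum, Finset.mul_sum]
      refine Finset.sum_congr rfl fun n _ => ?_
      rw [periodIntegral_zero_infty, periodIntegrand]
      simp only [map_mul, map_pow, hcz, Complex.conj_I]
      linear_combination (-(-1 : ℂ) ^ n * (m.choose n : ℂ) *
        verticalPrimitive (periodIntegrand (m - n) (u j)) 0 * (z⁻¹) ^ n *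
          conj (v j (ofComplex z)) * z⁻¹) * Complex.I_mul_I
    rw [Finset.sum_congr rfl fun j _ => e3 j, ← Finset.mul_sum]
    field_simp
    ring
  have hJsum : J = ∫ θ in (0 : ℝ)..Real.pi, ∑ j, Complex.exp (-(θ * Complex.I)) *
      eichlerPairing m (u j) (v j) (Complex.exp (θ * Complex.I)) := by
    rw [intervalIntegral.integral_finsetSum fun j _ => (stokes j).2.1]
  have iJ : IntervalIntegrable (fun θ : ℝ => ∑ j, Complex.exp (-(θ * Complex.I)) *
      eichlerPairing m (u j) (v j) (Complex.exp (θ * Complex.I))) volume 0 Real.pi := by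
    have := IntervalIntegrable.sum Finset.univ fun j _ => (stokes j).2.1
    rwa [Finset.sum_fn] at this
  have iV : ∀ j n, IntervalIntegrable (fun θ : ℝ =>
      conj (periodIntegrand n (v j) (Complex.exp (θ * Complex.I)) *
          (Complex.I * Complex.exp (θ * Complex.I)))) volume 0 Real.pi := fun j n => by
    have := (hv j).intervalIntegrable_arc n
    rw [intervalIntegrable_iff_integrableOn_Ioo_of_le Real.pi_pos.le] at this ⊢
    exact (Complex.conjLIE.integrable_comp_iff).mpr this
  have iK : IntervalIntegrable (fun θ : ℝ => ∑ j, ∑ n ∈ Finset.range (m + 1),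
      (-1 : ℂ) ^ n * (m.choose n : ℂ) *
        periodIntegral (m - n) ((0 : ℂ) : OnePoint ℂ) ∞ (u j) * (-Complex.I) *
        conj (periodIntegrand n (v j) (Complex.exp (θ * Complex.I)) *
          (Complex.I * Complex.exp (θ * Complex.I)))) volume 0 Real.pi := by
    have := IntervalIntegrable.sum Finset.univ fun j (_ : j ∈ (Finset.univ : Finset (Fin r))) =>
      IntervalIntegrable.sum (Finset.range (m + 1)) fun n _ => (iV j n).const_mul
        ((-1 : ℂ) ^ n * (m.choose n : ℂ) *
          periodIntegral (m - n) ((0 : ℂ) : OnePoint ℂ) ∞ (u j) * (-Complex.I))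
    simpa only [Finset.sum_fn] using this
  have hKint : ∫ θ in (0 : ℝ)..Real.pi, ∑ j, ∑ n ∈ Finset.range (m + 1),
      (-1 : ℂ) ^ n * (m.choose n : ℂ) *
        periodIntegral (m - n) ((0 : ℂ) : OnePoint ℂ) ∞ (u j) * (-Complex.I) *
        conj (periodIntegrand n (v j) (Complex.exp (θ * Complex.I)) *
          (Complex.I * Complex.exp (θ * Complex.I))) = Complex.I * K := by
    rw [intervalIntegral.integral_finsetSum fun j _ => by
      have := IntervalIntegrable.sum (Finset.range (m + 1)) fun n _ => (iV j n).const_mul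
        ((-1 : ℂ) ^ n * (m.choose n : ℂ) *
          periodIntegral (m - n) ((0 : ℂ) : OnePoint ℂ) ∞ (u j) * (-Complex.I))
      simpa only [Finset.sum_fn] using this, hK, Finset.mul_sum]
    refine Finset.sum_congr rfl fun j _ => ?_
    rw [intervalIntegral.integral_finsetSum fun n _ => (iV j n).const_mul _, Finset.mul_sum]
    refine Finset.sum_congr rfl fun n _ => ?_
    have hconj : ∫ θ in (0 : ℝ)..Real.pi, conj (periodIntegrand n (v j)
        (Complex.exp (θ * Complex.I)) * (Complex.I * Complex.exp (θ * Complex.I))) =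
        -conj (periodIntegral n ((-1 : ℂ) : OnePoint ℂ) ((1 : ℂ) : OnePoint ℂ) (v j)) := by
      rw [periodIntegral_neg_one_one, map_neg, neg_neg,
        intervalIntegral.integral_of_le Real.pi_pos.le,
        intervalIntegral.integral_of_le Real.pi_pos.le, integral_conj]
    rw [intervalIntegral.integral_const_mul, hconj]
    ring
  -- Substituting `θ ↦ π - θ` preserves the integral over `[0, π]`, while `hpt` rewrites the
  -- substituted integrand.
  have hJK : J = -J + Complex.I * K := by
    have h1 : J = ∫ θ in (0 : ℝ)..Real.pi,
        ∑ j, Complex.exp (-(((Real.pi - θ : ℝ) : ℂ) * Complex.I)) *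
        eichlerPairing m (u j) (v j) (Complex.exp (((Real.pi - θ : ℝ) : ℂ) * Complex.I)) := by
      rw [intervalIntegral.integral_comp_sub_left (fun θ : ℝ => ∑ j, Complex.exp (-(θ * Complex.I)) *
        eichlerPairing m (u j) (v j) (Complex.exp (θ * Complex.I))) Real.pi, hJsum]
      simp
    conv_lhs => rw [h1]
    have hadd := intervalIntegral.integral_add iJ.neg iK
    simp only [Pi.neg_apply] at hadd
    rw [← hKint, hJsum, ← intervalIntegral.integral_neg, ← hadd,
      intervalIntegral.integral_of_le Real.pi_pos.le,
      intervalIntegral.integral_of_le Real.pi_pos.le, integral_Ioc_eq_integral_Ioo,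
      integral_Ioc_eq_integral_Ioo]
    exact setIntegral_congr_fun measurableSet_Ioo hpt
  rw [hstokes] at hJK
  have hI := Complex.I_mul_I
  rw [pow_succ]
  linear_combination (-Complex.I) * hJK - K * hI
end

/-! ### Petersson density, characters and assembly -/

section

variable (k : ℕ) (u v : ℍ → ℂ)

/-- The arguments are exchanged because `petersson` conjugates its first argument. -/
lemma peterssonDensity_eq_petersson (τ : ℍ) :
    peterssonDensity k u v τ = petersson k v u τ := by
  simp only [peterssonDensity, petersson, Complex.ofReal_zpow]
  ring

lemma peterssonDensity_slash (δ : SL(2, ℤ)) (τ : ℍ) :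
    peterssonDensity k (u ∣[(k : ℤ)] δ) (v ∣[(k : ℤ)] δ) τ = peterssonDensity k u v (δ • τ) := by
  simp only [peterssonDensity_eq_petersson, petersson_slash_SL]

lemma peterssonDensity_smul_smul (c d : ℂ) (τ : ℍ) :
    peterssonDensity k (c • u) (d • v) τ = c * conj d * peterssonDensity k u v τ := by
  simp only [peterssonDensity, Pi.smul_apply, smul_eq_mul, map_mul]
  ring

end

/-- A single density need not be invariant under all of `SL₂(ℤ)`. The sum over cosets is, which is
what allows the triangle to be cut into three modular domains. -/
lemma SlashInvariantSum.sum_peterssonDensity_smul {k r : ℕ} {u v : Fin r → ℍ → ℂ}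
    (huv : SlashInvariantSum k u v) (δ : SL(2, ℤ)) (τ : ℍ) :
    ∑ j, peterssonDensity k (u j) (v j) (δ • τ) = ∑ j, peterssonDensity k (u j) (v j) τ := by
  rw [← huv δ (fun p q => peterssonDensity k p q τ) fun c d p q =>
    peterssonDensity_smul_smul k p q c d τ]
  simp only [peterssonDensity_slash]

lemma isUnit_of_mem_Gamma0 {N : ℕ} {α : SL(2, ℤ)} (hα : α ∈ Gamma0 N) :
    IsUnit ((α 1 1 : ℤ) : ZMod N) := by
  have hdet := congrArg (Int.cast : ℤ → ZMod N) α.det_coe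
  rw [Matrix.det_fin_two] at hdet
  push_cast at hdet
  rw [Gamma0_mem.mp hα, mul_zero, sub_zero, mul_comm] at hdet
  exact IsUnit.of_mul_eq_one _ hdet

/-- The determinant condition makes the lower right entry a unit modulo `N`, so the character value
has absolute value one. -/
lemma character_mul_conj {N : ℕ} (χ : DirichletCharacter ℂ N) {α : SL(2, ℤ)}
    (hα : α ∈ Gamma0 N) :
    χ ((α 1 1 : ℤ) : ZMod N) * conj (χ ((α 1 1 : ℤ) : ZMod N)) = 1 := by
  have h := χ.unit_norm_eq_one (isUnit_of_mem_Gamma0 hα).unit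
  rw [IsUnit.unit_spec] at h
  rw [Complex.mul_conj, Complex.normSq_eq_norm_sq, h]
  simp

section

variable {N k : ℕ} {χ : DirichletCharacter ℂ N}

/-- From `γ_j δ = α γ_{σ j}` both translates acquire the same factor `χ(d)`, once conjugated, so it
drops out; the permutation `σ` only reorders the sum. -/
lemma slashInvariantSum_of_character (f g : cuspFormsWithCharacter N (k : ℤ) χ) {r : ℕ}
    {γ : Fin r → SL(2, ℤ)} (hγ : IsRightCosetDecomposition N γ) :
    SlashInvariantSum k (fun j => (f.1 : ℍ → ℂ) ∣[(k : ℤ)] γ j)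
      (fun j => (g.1 : ℍ → ℂ) ∣[(k : ℤ)] γ j) := by
  intro δ B hB
  obtain ⟨σ, hσ⟩ := hγ.exists_perm δ
  rw [← Equiv.sum_comp σ fun j => B ((f.1 : ℍ → ℂ) ∣[(k : ℤ)] γ j) ((g.1 : ℍ → ℂ) ∣[(k : ℤ)] γ j)]
  refine Finset.sum_congr rfl fun j _ => ?_
  obtain ⟨α, hα, h⟩ := hσ j
  dsimp only
  rw [← SlashAction.slash_mul, ← SlashAction.slash_mul, h, SlashAction.slash_mul,
    SlashAction.slash_mul, f.2 α hα, g.2 α hα, ModularForm.SL_smul_slash,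
    ModularForm.SL_smul_slash, hB, character_mul_conj χ hα, one_mul]

lemma peterssonDensity_smul_of_mem_Gamma0 (f g : cuspFormsWithCharacter N (k : ℤ) χ)
    {α : SL(2, ℤ)} (hα : α ∈ Gamma0 N) (τ : ℍ) :
    peterssonDensity k f.1 g.1 (α • τ) = peterssonDensity k f.1 g.1 τ := by
  rw [← peterssonDensity_slash, f.2 α hα, g.2 α hα, peterssonDensity_smul_smul,
    character_mul_conj χ hα, one_mul]

lemma isCuspidal_slash [NeZero N] (f : cuspFormsWithCharacter N (k : ℤ) χ) (δ : SL(2, ℤ)) :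
    IsCuspidal k ((f.1 : ℍ → ℂ) ∣[(k : ℤ)] δ) :=
  (isCuspidal_of_cuspFormClass f.1).slash δ

end

lemma fdo_subset_thetaDomain : 𝒟ᵒ ⊆ thetaDomain := fun _ hτ => ⟨hτ.2.trans (by norm_num), hτ.1⟩

/-- Inherited from the triangle, which contains the open standard domain. -/
lemma IsCuspidal.integrableOn_fd {m : ℕ} {u v : ℍ → ℂ} (hu : IsCuspidal (m + 2) u)
    (hv : IsCuspidal (m + 2) v) : IntegrableOn (peterssonDensity (m + 2) u v) 𝒟 :=
  ((eichlerPairing_stokes hu hv).1.mono_set fdo_subset_thetaDomain).congr_set_ae fd_ae_eq_fdo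

lemma SlashInvariantSum.sum_setIntegral_thetaDomain {m r : ℕ} {u v : Fin r → ℍ → ℂ}
    (hu : ∀ j, IsCuspidal (m + 2) (u j)) (hv : ∀ j, IsCuspidal (m + 2) (v j))
    (huv : SlashInvariantSum (m + 2) u v) :
    ∑ j, ∫ τ in thetaDomain, peterssonDensity (m + 2) (u j) (v j) τ =
      3 * ∑ j, ∫ τ in 𝒟, peterssonDensity (m + 2) (u j) (v j) τ := by
  have h := fun j => (eichlerPairing_stokes (hu j) (hv j)).1
  rw [← integral_finsetSum _ fun j _ => h j,
    ← integral_finsetSum _ fun j _ => (hu j).integrableOn_fd (hv j)]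
  exact setIntegral_thetaDomain huv.sum_peterssonDensity_smul (integrable_finsetSum _ fun j _ => h j)

end HaberlandPetersson

theorem mainTheorem1 (N : ℕ) [NeZero N] (k : ℕ) (hk : 2 ≤ k) (χ : DirichletCharacter ℂ N)
    (f g : HaberlandPetersson.cuspFormsWithCharacter N (k : ℤ) χ)
    (r : ℕ) (γ : Fin r → SL(2, ℤ))
    (hγ : HaberlandPetersson.IsRightCosetDecomposition N γ) :
    -- the integrals of the two sides converge absolutely
    (∀ j, ∀ n ∈ Finset.range (k - 1),
      HaberlandPetersson.PeriodIntegrable n ((0 : ℂ) : OnePoint ℂ) ∞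
        ((f.1 : ℍ → ℂ) ∣[(k : ℤ)] γ j) ∧
      HaberlandPetersson.PeriodIntegrable n ((-1 : ℂ) : OnePoint ℂ) ((1 : ℂ) : OnePoint ℂ)
        ((g.1 : ℍ → ℂ) ∣[(k : ℤ)] γ j)) ∧
    (∃ D : Set ℍ, HaberlandPetersson.IsGamma0FundamentalDomain N D) ∧
    ∀ D : Set ℍ, HaberlandPetersson.IsGamma0FundamentalDomain N D →
      IntegrableOn (fun τ : ℍ => f.1 τ * conj (g.1 τ) * ((τ.im ^ (k : ℤ) : ℝ) : ℂ)) D volume ∧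
      6 * (r : ℂ) * (2 * Complex.I) ^ (k - 1) *
          HaberlandPetersson.peterssonProduct N (k : ℤ) D f.1 g.1 =
        ∑ j : Fin r, ∑ n ∈ Finset.range (k - 1),
          (-1 : ℂ) ^ n * ((k - 2).choose n : ℂ) *
            HaberlandPetersson.periodIntegral (k - 2 - n) ((0 : ℂ) : OnePoint ℂ) ∞
              ((f.1 : ℍ → ℂ) ∣[(k : ℤ)] γ j) *
            conj (HaberlandPetersson.periodIntegral n ((-1 : ℂ) : OnePoint ℂ)
              ((1 : ℂ) : OnePoint ℂ) ((g.1 : ℍ → ℂ) ∣[(k : ℤ)] γ j)) := by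
  open HaberlandPetersson in
  obtain ⟨m, rfl⟩ : ∃ m, k = m + 2 := ⟨k - 2, by omega⟩
  have hf := fun j => isCuspidal_slash f (γ j)
  have hg := fun j => isCuspidal_slash g (γ j)
  refine ⟨fun j n _ => ⟨(hf j).periodIntegrable_zero_infty n, (hg j).periodIntegrable_neg_one_one n⟩,
    ⟨_, isGamma0FundamentalDomain_unionTranslates hγ⟩, fun D hD => ?_⟩
  obtain ⟨hint, heq⟩ := setIntegral_gamma0FundamentalDomain hγ hD
    (fun α hα => peterssonDensity_smul_of_mem_Gamma0 f g hα) fun j => by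
      simp only [← peterssonDensity_slash]
      exact (hf j).integrableOn_fd (hg j)
  refine ⟨hint, ?_⟩
  have hinv := slashInvariantSum_of_character f g hγ
  -- The normalizing factor is `r⁻¹`, since `r` is the index; finiteness of the index lets it cancel
  -- against the factor `r` in the formula.
  have hr : (r : ℂ) ≠ 0 := by
    rw [← hγ.index_eq]
    exact_mod_cast Subgroup.FiniteIndex.index_ne_zero
  have hformula := haberland_thetaDomain hf hg hinv
  rw [hinv.sum_setIntegral_thetaDomain hf hg] at hformula
  simp only [← peterssonDensity_slash] at heq
  have hP : peterssonProduct N ((m + 2 : ℕ) : ℤ) D f.1 g.1 =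
      (r : ℂ)⁻¹ * ∫ τ in D, peterssonDensity (m + 2) f.1 g.1 τ := by
    rw [← hγ.index_eq]
    rfl
  rw [hP, heq]
  refine Eq.trans ?_ hformula
  rw [show m + 2 - 1 = m + 1 by omega]
  field_simp
  ring
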